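/- Let $\Omega\subseteq\mathbb R^2$ be a non-empty open set and let $I\subseteq\mathbb R$ be its projection to the $x$-axis. A function on an open set is called *generically smooth* if it is defined and $C^\infty$ on a dense open subset of that set; two such functions are identified if they agree on a dense open subset. Let $K$ be a differential field of generically smooth real functions on $\Omega$, that is, a ring of such functions in which every non-zero element is invertible and which is closed under $\partial/\partial x$ and $\partial/\partial y$; suppose that every $f\in K$ with $\partial f/\partial y=0$ is a function of $x$ alone, i.e. $f(x,y)=\varphi(x)$ with $\varphi$ generically smooth on $I$. Let $K_x\subseteq K$ be the set of elements of $K$ that are functions of $x$ alone. (For example $K=\mathbb Q(x,y)$, $K_x=\mathbb Q(x)$.) An *operator over* $C\subseteq K$ is a linear ordinary differential operator $a_0+a_1D+\dots+a_nD^n$, $D=\partial/\partial x$, $a_i\in C$. A *multiintegral* is an expression $\overline L\mathring\varphi=L_1\varphi_1+\dots+L_k\varphi_k$, where $\overline L=(L_1,\dots,L_k)$, $k\ge 0$, is a row of operators over $K$ (the empty row is allowed) and $\mathring\varphi=(\varphi_1,\dots,\varphi_k)^t$ is a column of arbitrary generically smooth functions of $x\in I$. Its *function stock* is the set of all functions of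 $(x,y)$ obtained by substituting all such columns $\mathring\varphi$. A $p\times k$ matrix $\widehat R$ of operators over $K_x$ is *invertible* if there is a $k\times p$ matrix $\widehat S$ of operators over $K_x$ such that $\widehat R\widehat S$ and $\widehat S\widehat R$ are identity matrices. Its *rank* is the number of non-zero rows of an echelon matrix obtained from it by transpositions of rows and additions to a row of another row multiplied on the left by an operator over $K_x$. A multiintegral $\overline L\mathring\varphi$ with $k$ components is *(operator-)reducible* if $\overline L=\overline M\widehat R$ for some $p\le k$, some row $\overline M$ of $p$ operators over $K$ and some non-invertible $p\times k$ matrix $\widehat R$ of operators over $K_x$; otherwise it is *irreducible*. **Proposition.** Let a multiintegral $\overline L\mathring\varphi$ be given. 1. There is an irreducible multiintegral $\overline L_0\mathring\psi$ with the same function stock as $\overline L\mathring\varphi$. 2. It is unique up to multiplication of $\overline L_0$ on the right by an invertible operator matrix: if $\overline L_0\mathring\psi$ is irreducible with this stock, then a multiintegral $\overline L_1\mathring\xi$ is irreducible with this stock if and only if $\overline L_1=\overline L_0\widehat R$ for some invertible matrix $\widehat R$ of operators over $K_x$. 3. If $\overline L_0\mathring\psi$ is irreducible with this stock, then the multiintegrals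 with this stock are exactly those of the form $\overline L_0\widehat S\mathring\varphi$, where $\widehat S$ is an arbitrary matrix of operators over $K_x$ whose rank equals the number of its rows. -/

import Mathlib

open Filter Topology TopologicalSpace
open scoped ContDiff Matrix

noncomputable section

namespace EulerInt

/-! ### Functions defined generically on an open set -/

/-- The filter of all sets that contain a dense open subset of the open set `Ω`. -/
def generic {X : Type*} [TopologicalSpace X] (Ω : Opens X) : Filter X where
  sets := {s | ∃ U : Set X, IsOpen U ∧ U ⊆ Ω ∧ (Ω : Set X) ⊆ closure U ∧ U ⊆ s}
  univ_sets := ⟨Ω, Ω.isOpen, le_rfl, subset_closure, Set.subset_univ _⟩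
  sets_of_superset := by
    rintro s t ⟨U, hU, h1, h2, h3⟩ hst
    exact ⟨U, hU, h1, h2, h3.trans hst⟩
  inter_sets := by
    rintro s t ⟨U, hU, hU1, hU2, hU3⟩ ⟨V, hV, hV1, hV2, hV3⟩
    refine ⟨U ∩ V, hU.inter hV, Set.inter_subset_left.trans hU1, ?_,
      Set.inter_subset_inter hU3 hV3⟩
    intro x hx
    rw [mem_closure_iff]
    intro W hW hxW
    obtain ⟨u, huW, huU⟩ := mem_closure_iff.1 (hU2 hx) W hW hxW
    obtain ⟨v, hv, hvV⟩ := mem_closure_iff.1 (hV2 (hU1 huU)) (W ∩ U) (hW.inter hU) ⟨huW, huU⟩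
    exact ⟨v, hv.1, hv.2, hvV⟩

theorem eventually_generic_nhds {X : Type*} [TopologicalSpace X] {Ω : Opens X} {P : X → Prop}
    (h : ∀ᶠ p in generic Ω, P p) : ∀ᶠ p in generic Ω, ∀ᶠ q in 𝓝 p, P q := by
  obtain ⟨U, hU, h1, h2, h3⟩ := h
  exact ⟨U, hU, h1, h2, fun p hp => Filter.mem_of_superset (hU.mem_nhds hp) h3⟩

section Smooth

variable {E : Type*} [NormedAddCommGroup E] [NormedSpace ℝ E]

/-- `f` is smooth on some dense open subset of `Ω` (elsewhere its values are irrelevant). -/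
def GenSmooth (Ω : Opens E) (f : E → ℝ) : Prop :=
  ∀ᶠ p in generic Ω, ContDiffAt ℝ ∞ f p

/-- The ring of real functions that are defined and smooth on a dense open subset of `Ω`, two such
functions being identified when they agree on a dense open subset of `Ω`. -/
def SmoothGen (Ω : Opens E) : Subring (Germ (generic Ω) ℝ) where
  carrier := {F | ∃ f : E → ℝ, GenSmooth Ω f ∧ F = (f : Germ (generic Ω) ℝ)}
  mul_mem' := by
    rintro _ _ ⟨f, hf, rfl⟩ ⟨g, hg, rfl⟩
    exact ⟨f * g, by filter_upwards [hf, hg] with p h1 h2 using h1.mul h2, rfl⟩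
  one_mem' := ⟨1, Eventually.of_forall fun _ => contDiffAt_const, rfl⟩
  add_mem' := by
    rintro _ _ ⟨f, hf, rfl⟩ ⟨g, hg, rfl⟩
    exact ⟨f + g, by filter_upwards [hf, hg] with p h1 h2 using h1.add h2, rfl⟩
  zero_mem' := ⟨0, Eventually.of_forall fun _ => contDiffAt_const, rfl⟩
  neg_mem' := by
    rintro _ ⟨f, hf, rfl⟩
    exact ⟨-f, by filter_upwards [hf] with p h1 using h1.neg, rfl⟩

/-- Derivative in the direction `v` of a function up to generic equality. -/
def germDeriv (Ω : Opens E) (v : E) : Germ (generic Ω) ℝ → Germ (generic Ω) ℝ :=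
  Quotient.map' (fun f p => fderiv ℝ f p v) (by
    intro f g h
    have h' : ∀ᶠ p in generic Ω, f p = g p := h
    change ∀ᶠ p in generic Ω, _ = _
    filter_upwards [eventually_generic_nhds h'] with p hp
    rw [Filter.EventuallyEq.fderiv_eq hp])

theorem germDeriv_coe (Ω : Opens E) (v : E) (f : E → ℝ) :
    germDeriv Ω v (f : Germ (generic Ω) ℝ) = ((fun p => fderiv ℝ f p v : E → ℝ) : Germ _ ℝ) := rfl

/-- The partial derivative in the direction `v`, as an additive endomorphism of the ring of
generically smooth functions. -/
def dirDeriv (Ω : Opens E) (v : E) : AddMonoid.End (SmoothGen Ω) where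
  toFun F := ⟨germDeriv Ω v F.1, by
    obtain ⟨_, f, hf, rfl⟩ := F
    refine ⟨_, ?_, germDeriv_coe Ω v f⟩
    unfold GenSmooth
    filter_upwards [hf] with p hp
    exact (hp.fderiv_right (m := ∞) (by simp)).clm_apply contDiffAt_const⟩
  map_zero' := by
    apply Subtype.ext
    change germDeriv Ω v ((fun _ => 0 : E → ℝ) : Germ (generic Ω) ℝ) = 0
    rw [germDeriv_coe]
    simp
    rfl
  map_add' := by
    rintro ⟨_, f, hf, rfl⟩ ⟨_, g, hg, rfl⟩
    apply Subtype.ext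
    change germDeriv Ω v ((f + g : E → ℝ) : Germ (generic Ω) ℝ) = germDeriv Ω v f + germDeriv Ω v g
    simp only [germDeriv_coe]
    rw [← Germ.coe_add]
    apply Germ.coe_eq.2
    filter_upwards [hf, hg] with p h1 h2
    rw [fderiv_add (h1.differentiableAt (by simp)) (h2.differentiableAt (by simp))]
    rfl

end Smooth

/-! ### Functions in the plane -/

/-- Generically smooth functions `f(x,y)` on the open set `Ω` of the plane. -/
abbrev Fun (Ω : Opens (ℝ × ℝ)) : Type := SmoothGen Ω

/-- `D = ∂/∂x`. -/
def Dx (Ω : Opens (ℝ × ℝ)) : AddMonoid.End (Fun Ω) := dirDeriv Ω (1, 0)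

/-- `∂/∂y`. -/
def Dy (Ω : Opens (ℝ × ℝ)) : AddMonoid.End (Fun Ω) := dirDeriv Ω (0, 1)

/-- The projection of `Ω` to the `x`-axis. -/
def xProj (Ω : Opens (ℝ × ℝ)) : Opens ℝ := ⟨Prod.fst '' (Ω : Set (ℝ × ℝ)), isOpenMap_fst _ Ω.isOpen⟩

/-- `F` is a function of `x` alone: `F(x,y) = φ(x)` with `φ` smooth on a dense open subset of the
projection of `Ω`. -/
def DependsOnX {Ω : Opens (ℝ × ℝ)} (F : Fun Ω) : Prop :=
  ∃ φ : ℝ → ℝ, GenSmooth (xProj Ω) φ ∧ F.1 = ((fun p => φ p.1 : ℝ × ℝ → ℝ) : Germ (generic Ω) ℝ)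

/-- A differential field of functions on `Ω`: a ring of generically smooth functions in which
nonzero elements are invertible, closed under both partial derivatives, and in which vanishing of
the derivative in `y` characterizes the functions of `x` alone. -/
structure FunctionField (Ω : Opens (ℝ × ℝ)) extends Subring (Fun Ω) where
  exists_inv : ∀ f ∈ carrier, f ≠ 0 → ∃ g ∈ carrier, f * g = 1
  dx_mem : ∀ f ∈ carrier, Dx Ω f ∈ carrier
  dy_mem : ∀ f ∈ carrier, Dy Ω f ∈ carrier
  dependsOnX_of_dy_eq_zero : ∀ f ∈ carrier, Dy Ω f = 0 → DependsOnX f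

/-- The elements of the field that depend on `x` only. -/
def FunctionField.xPart {Ω : Opens (ℝ × ℝ)} (K : FunctionField Ω) : Set (Fun Ω) :=
  {f | f ∈ K.carrier ∧ DependsOnX f}

/-! ### Linear ordinary differential operators in `x` and matrices of them

Operators are regarded as additive endomorphisms of the ring of functions; multiplication is
composition. -/

/-- Operators acting on functions in the plane. -/
abbrev Op (Ω : Opens (ℝ × ℝ)) : Type := AddMonoid.End (Fun Ω)

/-- `P = a₀ + a₁ D + … + a_n D^n` with coefficients in `C`. -/
def IsLODO {Ω : Opens (ℝ × ℝ)} (C : Set (Fun Ω)) (P : Op Ω) : Prop :=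
  ∃ (n : ℕ) (a : ℕ → Fun Ω), (∀ i, a i ∈ C) ∧
    P = ∑ i ∈ Finset.range (n + 1), (AddMonoid.End.mulLeft (a i) : Op Ω) * Dx Ω ^ i

/-- All entries of the matrix are differential operators with coefficients in `C`. -/
def MatOver {Ω : Opens (ℝ × ℝ)} (C : Set (Fun Ω)) {p k : ℕ} (R : Matrix (Fin p) (Fin k) (Op Ω)) :
    Prop :=
  ∀ i j, IsLODO C (R i j)

/-- All entries of the row are differential operators with coefficients in `C`. -/
def RowOver {Ω : Opens (ℝ × ℝ)} (C : Set (Fun Ω)) {k : ℕ} (L : Fin k → Op Ω) : Prop :=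
  ∀ i, IsLODO C (L i)

/-- Existence of a two-sided inverse operator matrix with coefficients in `C`. -/
def MatInvertible {Ω : Opens (ℝ × ℝ)} (C : Set (Fun Ω)) {p k : ℕ}
    (R : Matrix (Fin p) (Fin k) (Op Ω)) : Prop :=
  ∃ S : Matrix (Fin k) (Fin p) (Op Ω), MatOver C S ∧ R * S = 1 ∧ S * R = 1

/-- Row operations: transposition of two rows, and addition to a row of another row multiplied on
the left by a differential operator with coefficients in `C`. -/
inductive RowReduces {Ω : Opens (ℝ × ℝ)} (C : Set (Fun Ω)) {p k : ℕ}
    (A : Matrix (Fin p) (Fin k) (Op Ω)) : Matrix (Fin p) (Fin k) (Op Ω) → Prop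
  | refl : RowReduces C A A
  | swap (B : Matrix (Fin p) (Fin k) (Op Ω)) (i j : Fin p) (h : RowReduces C A B) :
      RowReduces C A (B.submatrix (Equiv.swap i j) id)
  | add (B : Matrix (Fin p) (Fin k) (Op Ω)) (i j : Fin p) (hij : i ≠ j) (T : Op Ω)
      (hT : IsLODO C T) (h : RowReduces C A B) :
      RowReduces C A (B.updateRow i fun c => B i c + T * B j c)

/-- `B` is an echelon matrix with exactly `r` nonzero rows (`q i` is the column of the pivot of
row `i`). -/
def IsEchelon {Ω : Opens (ℝ × ℝ)} {p k : ℕ} (B : Matrix (Fin p) (Fin k) (Op Ω)) (r : ℕ) : Prop :=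
  ∃ (hr : r ≤ p) (q : Fin r → Fin k), StrictMono q ∧
    (∀ i : Fin r, B (Fin.castLE hr i) (q i) ≠ 0 ∧ ∀ j < q i, B (Fin.castLE hr i) j = 0) ∧
    ∀ i : Fin p, r ≤ (i : ℕ) → ∀ j, B i j = 0

/-- The operator matrix `A` has rank `r`: by row operations it can be brought to an echelon matrix
with `r` nonzero rows. -/
def HasRank {Ω : Opens (ℝ × ℝ)} (C : Set (Fun Ω)) {p k : ℕ} (A : Matrix (Fin p) (Fin k) (Op Ω))
    (r : ℕ) : Prop :=
  ∃ B, RowReduces C A B ∧ IsEchelon B r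

/-! ### Multiintegrals

A multiintegral `L₁(x,y)φ₁(x) + … + L_k(x,y)φ_k(x)` is given by its operator row `L`. -/

/-- The function stock: the set of all values `L₁φ₁ + … + L_kφ_k`, where the `φ_i` are arbitrary
smooth functions of `x`. -/
def stock {Ω : Opens (ℝ × ℝ)} {k : ℕ} (L : Fin k → Op Ω) : Set (Fun Ω) :=
  {F | ∃ φ : Fin k → Fun Ω, (∀ i, DependsOnX (φ i)) ∧ F = ∑ i, L i (φ i)}

/-- `L = M R` with `p ≤ k` and a non-invertible `p × k` matrix `R` of operators whose coefficients
depend on `x` only. -/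
def OperatorReducible {Ω : Opens (ℝ × ℝ)} (K : FunctionField Ω) {k : ℕ} (L : Fin k → Op Ω) :
    Prop :=
  ∃ (p : ℕ) (M : Fin p → Op Ω) (R : Matrix (Fin p) (Fin k) (Op Ω)),
    p ≤ k ∧ RowOver K.carrier M ∧ MatOver K.xPart R ∧ ¬ MatInvertible K.xPart R ∧ L = M ᵥ* R

/-- Irreducible operator rows over `K`. -/
def Irred {Ω : Opens (ℝ × ℝ)} (K : FunctionField Ω) {k : ℕ} (L : Fin k → Op Ω) : Prop :=
  RowOver K.carrier L ∧ ¬ OperatorReducible K L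

end EulerInt

end

/-! Choose a basis `e` of K over K_x. Every operator row over K is then `L = ∑ e_i A_i`, with a
matrix `A` of operators over K_x that has finitely many non-zero rows (`IsXBasis.exists_coord`).
Since elements of K with vanishing y-derivative are functions of x, the basis stays independent over
all generically smooth functions of x, not only over K_x (`indep_xFun`). Hence a value `Lφ`
determines the whole column `Aφ`, and questions about stocks become linear algebra over the ring of
operators over K_x.

This ring has division with remainder (`exists_div`), so row reduction works and its left ideals are
principal. Reduction to echelon form factors `A = A₀H`, where `A₀` has a left inverse and `H` is
echelon without zero rows (`IsXBasis.exists_factorization`). A non-zero operator over K_x maps the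
functions of x onto themselves (`exists_solution`), so back substitution makes `H` surjective
(`xSurj_of_isEchelon`). The row `M` with coordinates `A₀` therefore has the stock of `L`.

A row is irreducible exactly when its coordinate matrix has a left inverse. If `TA = 1` and `L =
NR`, then `A = A'R`, so `R` has the left inverse `TA'`; over a Noetherian ring a p × k matrix with a
left inverse and p ≤ k is square and invertible (`HasLeftInv.irred`). Conversely, irreducibility
forces the factor `H` above to be invertible (`IsXBasis.hasLeftInv_of_irred`).

A left inverse recovers the argument ψ from the value `L₀ψ` by operators. So a row `L₁` with the
same stock satisfies `L₁φ = L₀Sφ` for one operator matrix `S`, whence `L₁ = L₀S`; equality of stocks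
makes `S` surjective, that is, of full row rank (`hasRank_iff_xSurj`). If `L₁` is irreducible too,
its irreducibility makes `S` invertible. -/

noncomputable section

namespace EulerInt

/-! ### Generic functions and the derivation rules -/

section Germs

variable {E : Type*} [NormedAddCommGroup E] [NormedSpace ℝ E]

/-- The class of a generically smooth function. -/
def SmoothGen.mk (Ω : Opens E) (f : E → ℝ) (hf : GenSmooth Ω f) : SmoothGen Ω :=
  ⟨(f : Germ (generic Ω) ℝ), f, hf, rfl⟩

theorem SmoothGen.exists_rep {Ω : Opens E} (F : SmoothGen Ω) :
    ∃ (f : E → ℝ) (hf : GenSmooth Ω f), F = SmoothGen.mk Ω f hf := by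
  obtain ⟨_, f, hf, rfl⟩ := F
  exact ⟨f, hf, rfl⟩

theorem dirDeriv_mul (Ω : Opens E) (v : E) (F G : SmoothGen Ω) :
    dirDeriv Ω v (F * G) = dirDeriv Ω v F * G + F * dirDeriv Ω v G := by
  obtain ⟨f, hf, rfl⟩ := SmoothGen.exists_rep F
  obtain ⟨g, hg, rfl⟩ := SmoothGen.exists_rep G
  apply Subtype.ext
  change germDeriv Ω v ((f * g : E → ℝ) : Germ (generic Ω) ℝ) =
    germDeriv Ω v f * g + f * germDeriv Ω v g
  simp only [germDeriv_coe]
  rw [← Germ.coe_mul, ← Germ.coe_mul, ← Germ.coe_add]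
  apply Germ.coe_eq.2
  filter_upwards [hf, hg] with p h1 h2
  rw [fderiv_mul (h1.differentiableAt (by simp)) (h2.differentiableAt (by simp))]
  simp [mul_comm]
  ring

theorem dirDeriv_one (Ω : Opens E) (v : E) : dirDeriv Ω v (1 : SmoothGen Ω) = 0 := by
  have h := dirDeriv_mul Ω v 1 1
  simpa using h

end Germs

/-! ### Functions of `x` alone -/

variable {Ω : Opens (ℝ × ℝ)}

/-- The projection is an open map, so preimages of dense open sets are dense. This makes the
pullback of classes of functions of x well defined. -/
theorem tendsto_fst_generic (Ω : Opens (ℝ × ℝ)) :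
    Tendsto Prod.fst (generic Ω) (generic (xProj Ω)) := by
  rintro s ⟨U, hU, h1, h2, h3⟩
  refine ⟨Prod.fst ⁻¹' U ∩ Ω, (hU.preimage continuous_fst).inter Ω.isOpen, Set.inter_subset_right,
    fun x hx => mem_closure_iff.2 fun W hW hxW => ?_, fun p hp => h3 hp.1⟩
  obtain ⟨u, ⟨w, hw, rfl⟩, hu⟩ := mem_closure_iff.1 (h2 ⟨x, hx, rfl⟩) (Prod.fst '' (W ∩ Ω))
    (isOpenMap_fst _ (hW.inter Ω.isOpen)) ⟨x, ⟨hxW, hx⟩, rfl⟩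
  exact ⟨w, hw.1, hu, hw.2⟩

theorem GenSmooth.comp_fst {φ : ℝ → ℝ} (h : GenSmooth (xProj Ω) φ) :
    GenSmooth Ω (fun p => φ p.1) := by
  filter_upwards [(tendsto_fst_generic Ω).eventually h] with p hp
  exact hp.comp p contDiffAt_fst

/-- Functions of `x`, regarded as functions of `(x, y)`. -/
def pull (Ω : Opens (ℝ × ℝ)) : SmoothGen (xProj Ω) →+* Fun Ω where
  toFun F := ⟨F.1.compTendsto Prod.fst (tendsto_fst_generic Ω), by
    obtain ⟨_, φ, hφ, rfl⟩ := F
    exact ⟨_, hφ.comp_fst, rfl⟩⟩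
  map_one' := rfl
  map_zero' := rfl
  map_add' := by
    rintro ⟨_, f, hf, rfl⟩ ⟨_, g, hg, rfl⟩
    rfl
  map_mul' := by
    rintro ⟨_, f, hf, rfl⟩ ⟨_, g, hg, rfl⟩
    rfl

theorem Dx_pull (F : SmoothGen (xProj Ω)) : Dx Ω (pull Ω F) = pull Ω (dirDeriv _ 1 F) := by
  obtain ⟨φ, hφ, rfl⟩ := SmoothGen.exists_rep F
  apply Subtype.ext
  apply Germ.coe_eq.2
  filter_upwards [(tendsto_fst_generic Ω).eventually hφ] with p hp
  have h : HasFDerivAt (φ ∘ Prod.fst : ℝ × ℝ → ℝ) _ p :=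
    (hp.differentiableAt (by simp)).hasFDerivAt.comp p hasFDerivAt_fst
  rw [h.fderiv]
  rfl

theorem Dy_pull (F : SmoothGen (xProj Ω)) : Dy Ω (pull Ω F) = 0 := by
  obtain ⟨φ, hφ, rfl⟩ := SmoothGen.exists_rep F
  apply Subtype.ext
  apply Germ.coe_eq.2
  filter_upwards [(tendsto_fst_generic Ω).eventually hφ] with p hp
  have h : HasFDerivAt (φ ∘ Prod.fst : ℝ × ℝ → ℝ) _ p :=
    (hp.differentiableAt (by simp)).hasFDerivAt.comp p hasFDerivAt_fst
  rw [h.fderiv]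
  simp

/-- The ring of functions of `x` alone. -/
def xFun (Ω : Opens (ℝ × ℝ)) : Subring (Fun Ω) := (pull Ω).range

theorem dependsOnX_iff {F : Fun Ω} : DependsOnX F ↔ F ∈ xFun Ω := by
  constructor
  · rintro ⟨φ, hφ, h⟩
    exact ⟨SmoothGen.mk _ φ hφ, Subtype.ext h.symm⟩
  · rintro ⟨G, rfl⟩
    obtain ⟨φ, hφ, rfl⟩ := SmoothGen.exists_rep G
    exact ⟨φ, hφ, rfl⟩

theorem Dx_mem_xFun {F : Fun Ω} (h : F ∈ xFun Ω) : Dx Ω F ∈ xFun Ω := by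
  obtain ⟨G, rfl⟩ := h
  exact ⟨_, (Dx_pull G).symm⟩

theorem Dy_of_mem_xFun {F : Fun Ω} (h : F ∈ xFun Ω) : Dy Ω F = 0 := by
  obtain ⟨G, rfl⟩ := h
  exact Dy_pull G

/-- The coordinate function `x`. -/
def xCoord (Ω : Opens (ℝ × ℝ)) : Fun Ω :=
  pull Ω (SmoothGen.mk _ id (Eventually.of_forall fun _ => contDiffAt_id))

theorem xCoord_mem (Ω : Opens (ℝ × ℝ)) : xCoord Ω ∈ xFun Ω := ⟨_, rfl⟩

theorem Dx_xCoord (Ω : Opens (ℝ × ℝ)) : Dx Ω (xCoord Ω) = 1 := by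
  rw [xCoord, Dx_pull, ← map_one (pull Ω)]
  congr 1
  apply Subtype.ext
  apply Germ.coe_eq.2
  exact Eventually.of_forall fun p => by simp

theorem nontrivial_fun (hΩ : (Ω : Set (ℝ × ℝ)).Nonempty) : Nontrivial (Fun Ω) := by
  refine ⟨0, 1, fun h => ?_⟩
  obtain ⟨U, -, -, h2, h3⟩ : ∀ᶠ p in generic Ω, (0 : ℝ × ℝ → ℝ) p = (1 : ℝ × ℝ → ℝ) p :=
    Germ.coe_eq.1 (congrArg Subtype.val h)
  obtain ⟨x, hx⟩ := hΩ
  have hU : U = ∅ := Set.eq_empty_of_forall_notMem fun p hp => zero_ne_one (h3 hp : (0 : ℝ) = 1)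
  have h4 := h2 hx
  simp [hU] at h4

/-! ### Linear differential systems with generically smooth coefficients -/

/-- A linear system with smooth coefficients has smooth solutions near every point. -/
theorem exists_local_solution {n : ℕ} {a : Fin n → Fin n → ℝ → ℝ} {h : Fin n → ℝ → ℝ} {U : Set ℝ}
    (hU : IsOpen U) (ha : ∀ t ∈ U, ∀ i j, ContDiffAt ℝ ∞ (a i j) t)
    (hh : ∀ t ∈ U, ∀ i, ContDiffAt ℝ ∞ (h i) t) {t₀ : ℝ} (ht₀ : t₀ ∈ U) :
    ∃ V : Set ℝ, IsOpen V ∧ t₀ ∈ V ∧ V ⊆ U ∧ ∃ y : ℝ → Fin n → ℝ, ∀ t ∈ V,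
      (∀ i, ContDiffAt ℝ ∞ (fun s => y s i) t) ∧
      ∀ i, HasDerivAt (fun s => y s i) (∑ j, a i j t * y t j + h i t) t := by
  -- Time becomes the first component of the unknown, which makes the system autonomous; `hα1`
  -- checks that this component is indeed t.
  set v : ℝ × (Fin n → ℝ) → ℝ × (Fin n → ℝ) :=
    fun z => (1, fun i => ∑ j, a i j z.1 * z.2 j + h i z.1) with hv
  have hvs : ∀ z : ℝ × (Fin n → ℝ), z.1 ∈ U → ContDiffAt ℝ ∞ v z := by
    intro z hz
    refine contDiffAt_const.prodMk (contDiffAt_pi.2 fun i => ?_)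
    refine (ContDiffAt.sum fun j _ => ?_).add ((hh _ hz i).comp z contDiffAt_fst)
    exact ((ha _ hz i j).comp z contDiffAt_fst).mul
      ((contDiffAt_pi.1 contDiffAt_id j).comp z contDiffAt_snd)
  obtain ⟨ε, hε, b, r, M, K, hr, hpl⟩ := IsPicardLindelof.of_contDiffAt_one
    ((hvs (t₀, 0) ht₀).of_le (by norm_cast))
  obtain ⟨α, hα0, hα⟩ := (hpl t₀).exists_eq_forall_mem_Icc_hasDerivWithinAt
    (Metric.mem_closedBall_self r.coe_nonneg)
  have hαd : ∀ t ∈ Set.Ioo (t₀ - ε) (t₀ + ε), HasDerivAt α (v (α t)) t := fun t ht =>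
    (hα t (Set.Ioo_subset_Icc_self ht)).hasDerivAt (Icc_mem_nhds ht.1 ht.2)
  have hα1 : ∀ t ∈ Set.Ioo (t₀ - ε) (t₀ + ε), (α t).1 = t := by
    have hc : ∀ t ∈ Set.Ioo (t₀ - ε) (t₀ + ε), HasDerivAt (fun s => (α s).1 - s) 0 t := by
      intro t ht
      have h1 : HasDerivAt (fun s => (α s).1) 1 t := by
        exact hasFDerivAt_fst.comp_hasDerivAt t (hαd t ht)
      simpa [Pi.sub_def] using h1.sub (hasDerivAt_id t)
    intro t ht
    have h0 : t₀ ∈ Set.Ioo (t₀ - ε) (t₀ + ε) := ⟨by linarith, by linarith⟩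
    have h2 := isOpen_Ioo.is_const_of_deriv_eq_zero isPreconnected_Ioo
      (fun s hs => (hc s hs).differentiableAt.differentiableWithinAt)
      (fun s hs => (hc s hs).deriv) ht h0
    simp only at hα0
    simp only [hα0] at h2
    linarith
  have hα2 : ∀ t ∈ Set.Ioo (t₀ - ε) (t₀ + ε) ∩ U, ContDiffAt ℝ ∞ α t := by
    intro t ht
    -- Smoothness of the solution follows from that of the field, on a compact interval around t
    -- where both are available.
    obtain ⟨δ, hδ, hball⟩ := Metric.isOpen_iff.1 (isOpen_Ioo.inter hU) t ht
    rw [Real.ball_eq_Ioo] at hball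
    have hsub : Set.Icc (t - δ / 2) (t + δ / 2) ⊆ Set.Ioo (t₀ - ε) (t₀ + ε) ∩ U :=
      fun s hs => hball ⟨by linarith [hs.1], by linarith [hs.2]⟩
    have h3 : ContDiffOn ℝ ((⊤ : ℕ∞) : WithTop ℕ∞) α (Set.Icc (t - δ / 2) (t + δ / 2)) := by
      apply ODE.contDiffOn_enat_Icc_of_hasDerivWithinAt (f := fun _ => v)
        (u := {z : ℝ × (Fin n → ℝ) | z.1 ∈ U})
      · intro z hz
        exact ((hvs z.2 hz.2).comp z contDiffAt_snd).contDiffWithinAt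
      · exact fun s hs => (hαd s (hsub hs).1).hasDerivWithinAt
      · intro s hs
        simpa [hα1 s (hsub hs).1] using (hsub hs).2
    exact h3.contDiffAt (Icc_mem_nhds (by linarith) (by linarith))
  refine ⟨Set.Ioo (t₀ - ε) (t₀ + ε) ∩ U, isOpen_Ioo.inter hU,
    ⟨⟨by linarith, by linarith⟩, ht₀⟩, Set.inter_subset_right, fun t => (α t).2, fun t ht => ?_⟩
  refine ⟨fun i => contDiffAt_pi.1 (contDiffAt_snd.comp t (hα2 t ht)) i, fun i => ?_⟩
  have h4 : HasDerivAt (fun s => (α s).2) (v (α t)).2 t := by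
    exact hasFDerivAt_snd.comp_hasDerivAt t (hαd t ht.1)
  have h5 := hasDerivAt_pi.1 h4 i
  simpa [hv, hα1 t ht.1] using h5

/-- Locally solvable problems are generically solvable: local solutions on disjoint open sets are
put together. -/
theorem exists_generic_of_local {X Y : Type*} [TopologicalSpace X] [Inhabited Y] {U : Set X}
    {P : (X → Y) → X → Prop} (hcongr : ∀ f g t, f =ᶠ[𝓝 t] g → P f t → P g t)
    (hloc : ∀ t₀ ∈ U, ∃ V : Set X, IsOpen V ∧ t₀ ∈ V ∧ V ⊆ U ∧ ∃ f, ∀ t ∈ V, P f t) :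
    ∃ W : Set X, IsOpen W ∧ W ⊆ U ∧ U ⊆ closure W ∧ ∃ f, ∀ t ∈ W, P f t := by
  let good : Set X → Prop := fun V => IsOpen V ∧ V ⊆ U ∧ ∃ f, ∀ t ∈ V, P f t
  -- Disjointness removes any compatibility condition between local solutions; maximality makes the
  -- union dense, since near a point off its closure another set could be added.
  obtain ⟨S, hS⟩ := zorn_subset {S : Set (Set X) | (∀ V ∈ S, good V) ∧ S.PairwiseDisjoint id} (by
    intro c hc hchain
    refine ⟨⋃₀ c, ⟨?_, ?_⟩, fun s hs => Set.subset_sUnion_of_mem hs⟩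
    · rintro V ⟨s, hs, hV⟩
      exact (hc hs).1 V hV
    · exact (Set.pairwiseDisjoint_sUnion hchain.directedOn).2 fun s hs => (hc hs).2)
  obtain ⟨hgood, hdisj⟩ := hS.prop
  have hgood' : ∀ V : S, ∃ f, ∀ t ∈ (V : Set X), P f t := fun V => (hgood V V.2).2.2
  choose F hF using hgood'
  classical
  let f : X → Y := fun t => if h : ∃ V : S, t ∈ (V : Set X) then F h.choose t else default
  have hf : ∀ (V : S), ∀ t ∈ (V : Set X), f t = F V t := by
    intro V t ht
    have h : ∃ V : S, t ∈ (V : Set X) := ⟨V, ht⟩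
    have hV : h.choose = V := Subtype.ext (hdisj.elim_set h.choose.2 V.2 t h.choose_spec ht)
    simp only [f, dif_pos h]
    rw [hV]
  refine ⟨⋃₀ S, isOpen_sUnion fun V hV => (hgood V hV).1,
    Set.sUnion_subset fun V hV => (hgood V hV).2.1, fun t ht => ?_, f, ?_⟩
  · by_contra hcl
    obtain ⟨V, hVo, htV, hVU, g, hg⟩ := hloc t ht
    set V' := V ∩ (closure (⋃₀ S))ᶜ
    have hV' : good V' := ⟨hVo.inter isClosed_closure.isOpen_compl, Set.inter_subset_left.trans hVU,
      g, fun s hs => hg s hs.1⟩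
    have hdV : ∀ W ∈ S, Disjoint V' W := fun W hW => Set.disjoint_left.2 fun s hs hsW =>
      hs.2 (subset_closure ⟨W, hW, hsW⟩)
    have hmem : V' ∈ S := by
      refine hS.le_of_ge (y := insert V' S) ⟨?_, ?_⟩ (Set.subset_insert _ _) (Set.mem_insert _ _)
      · rintro W (rfl | hW)
        exacts [hV', hgood W hW]
      · exact hdisj.insert fun W hW _ => hdV W hW
    exact hcl (subset_closure ⟨V', hmem, htV, hcl⟩)
  · rintro t ⟨V, hV, ht⟩
    refine hcongr (F ⟨V, hV⟩) f t ?_ (hF ⟨V, hV⟩ t ht)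
    filter_upwards [(hgood V hV).1.mem_nhds ht] with s hs using (hf ⟨V, hV⟩ s hs).symm

/-- Linear differential systems are solvable in generically smooth functions. -/
theorem exists_solution_system {J : Opens ℝ} {n : ℕ} (a : Fin n → Fin n → SmoothGen J)
    (h : Fin n → SmoothGen J) :
    ∃ y : Fin n → SmoothGen J, ∀ i, dirDeriv J 1 (y i) = ∑ j, a i j * y j + h i := by
  choose a' ha ha' using fun i j => SmoothGen.exists_rep (a i j)
  choose h' hh hh' using fun i => SmoothGen.exists_rep (h i)
  have hev : ∀ᶠ t in generic J, (∀ i j, ContDiffAt ℝ ∞ (a' i j) t) ∧ ∀ i, ContDiffAt ℝ ∞ (h' i) t :=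
    (eventually_all.2 fun i => eventually_all.2 fun j => ha i j).and (eventually_all.2 hh)
  obtain ⟨U, hU, hUJ, hJU, hUs⟩ := hev
  obtain ⟨W, hW, hWU, hUW, y, hy⟩ := exists_generic_of_local
    (P := fun (y : ℝ → Fin n → ℝ) t => (∀ i, ContDiffAt ℝ ∞ (fun s => y s i) t) ∧
      ∀ i, HasDerivAt (fun s => y s i) (∑ j, a' i j t * y t j + h' i t) t)
    (by
      rintro f g t hfg ⟨h1, h2⟩
      have hi : ∀ i, (fun s => f s i) =ᶠ[𝓝 t] fun s => g s i := fun i => by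
        filter_upwards [hfg] with s hs using by rw [hs]
      refine ⟨fun i => (h1 i).congr_of_eventuallyEq (hi i).symm, fun i => ?_⟩
      rw [← hfg.eq_of_nhds]
      exact (h2 i).congr_of_eventuallyEq (hi i).symm)
    (fun t₀ ht₀ => exists_local_solution hU (fun t ht => (hUs ht).1) (fun t ht => (hUs ht).2) ht₀)
  have hmem : W ∈ generic J :=
    ⟨W, hW, hWU.trans hUJ, fun t ht => closure_minimal hUW isClosed_closure (hJU ht), le_rfl⟩
  have hys : ∀ i, GenSmooth J (fun s => y s i) := fun i => by
    unfold GenSmooth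
    filter_upwards [hmem] with t ht using (hy t ht).1 i
  refine ⟨fun i => SmoothGen.mk J _ (hys i), fun i => ?_⟩
  apply Subtype.ext
  have hR : (∑ j, a i j * SmoothGen.mk J _ (hys j) + h i : SmoothGen J).1 =
      ((fun t => ∑ j, a' i j t * y t j + h' i t : ℝ → ℝ) : Germ (generic J) ℝ) := by
    have hs : ∀ s : Finset (Fin n), (∑ j ∈ s, a i j * SmoothGen.mk J _ (hys j) : SmoothGen J).1 =
        ((fun t => ∑ j ∈ s, a' i j t * y t j : ℝ → ℝ) : Germ (generic J) ℝ) := by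
      intro s
      induction s using Finset.cons_induction with
      | empty => simp; rfl
      | cons j s hj ih =>
        simp only [Finset.sum_cons]
        rw [Subring.coe_add, ih, Subring.coe_mul, ha' i j]
        rfl
    rw [Subring.coe_add, hs, hh' i]
    rfl
  rw [hR]
  apply Germ.coe_eq.2
  filter_upwards [hmem] with t ht
  simpa using ((hy t ht).2 i).deriv

/-! ### Rings of differential operators -/

theorem op_mul_apply (P Q : Op Ω) (f : Fun Ω) : (P * Q) f = P (Q f) := rfl

theorem op_sub_apply (P Q : Op Ω) (f : Fun Ω) : (P - Q) f = P f - Q f := rfl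

theorem op_add_apply (P Q : Op Ω) (f : Fun Ω) : (P + Q) f = P f + Q f := rfl

theorem op_sum_apply {ι : Type*} (s : Finset ι) (P : ι → Op Ω) (f : Fun Ω) :
    (∑ i ∈ s, P i) f = ∑ i ∈ s, P i f :=
  map_sum (AddMonoidHom.eval f) P s

/-- Multiplication by a function, as an operator. -/
def mulOp (Ω : Opens (ℝ × ℝ)) : Fun Ω →+* Op Ω where
  toFun a := AddMonoid.End.mulLeft a
  map_one' := AddMonoidHom.ext fun f => one_mul f
  map_zero' := AddMonoidHom.ext fun f => zero_mul f
  map_add' a b := AddMonoidHom.ext fun f => add_mul a b f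
  map_mul' a b := AddMonoidHom.ext fun f => mul_assoc a b f

@[simp] theorem mulOp_apply (a f : Fun Ω) : mulOp Ω a f = a * f := rfl

theorem Dx_mul_mulOp (a : Fun Ω) :
    Dx Ω * mulOp Ω a = mulOp Ω a * Dx Ω + mulOp Ω (Dx Ω a) := by
  refine AddMonoidHom.ext fun f => ?_
  change Dx Ω (a * f) = a * Dx Ω f + Dx Ω a * f
  rw [Dx, dirDeriv_mul, add_comm]

/-- Differential operators of order less than `n` with coefficients in `C`. -/
def opLT (C : Subring (Fun Ω)) (n : ℕ) : AddSubgroup (Op Ω) where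
  carrier := {P | ∃ a : ℕ → Fun Ω, (∀ i, a i ∈ C) ∧
    P = ∑ i ∈ Finset.range n, mulOp Ω (a i) * Dx Ω ^ i}
  zero_mem' := ⟨0, fun _ => C.zero_mem, by simp⟩
  add_mem' := by
    rintro _ _ ⟨a, ha, rfl⟩ ⟨b, hb, rfl⟩
    exact ⟨a + b, fun i => C.add_mem (ha i) (hb i), by
      simp [add_mul, Finset.sum_add_distrib]⟩
  neg_mem' := by
    rintro _ ⟨a, ha, rfl⟩
    exact ⟨-a, fun i => C.neg_mem (ha i), by
      rw [← Finset.sum_neg_distrib]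
      exact Finset.sum_congr rfl fun i _ =>
        AddMonoidHom.ext fun f => (neg_mul (a i) ((Dx Ω ^ i) f)).symm⟩

section opLT

variable {C : Subring (Fun Ω)}

theorem monomial_mem_opLT {a : Fun Ω} (ha : a ∈ C) {i n : ℕ} (h : i < n) :
    mulOp Ω a * Dx Ω ^ i ∈ opLT C n := by
  refine ⟨fun j => if j = i then a else 0, fun j => ?_, ?_⟩
  · dsimp only
    split_ifs
    exacts [ha, C.zero_mem]
  · rw [Finset.sum_eq_single i]
    · simp
    · intro j _ hj
      simp [hj]
    · intro hi
      exact absurd (Finset.mem_range.2 h) hi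

theorem opLT_induction {n : ℕ} {P : Op Ω} (hP : P ∈ opLT C n) {H : AddSubgroup (Op Ω)}
    (hH : ∀ a ∈ C, ∀ i < n, mulOp Ω a * Dx Ω ^ i ∈ H) : P ∈ H := by
  obtain ⟨a, ha, rfl⟩ := hP
  exact sum_mem fun i hi => hH _ (ha i) i (Finset.mem_range.1 hi)

theorem opLT_mono {m n : ℕ} (h : m ≤ n) : opLT C m ≤ opLT C n := fun _ hP =>
  opLT_induction hP fun _ ha _ hi => monomial_mem_opLT ha (hi.trans_le h)

theorem mem_opLT_succ {n : ℕ} {P : Op Ω} :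
    P ∈ opLT C (n + 1) ↔ ∃ a ∈ C, ∃ Q ∈ opLT C n, P = mulOp Ω a * Dx Ω ^ n + Q := by
  constructor
  · rintro ⟨a, ha, rfl⟩
    exact ⟨a n, ha n, _, ⟨a, ha, rfl⟩, by rw [Finset.sum_range_succ, add_comm]⟩
  · rintro ⟨a, ha, Q, hQ, rfl⟩
    exact add_mem (monomial_mem_opLT ha n.lt_succ_self) (opLT_mono n.le_succ hQ)

theorem isLODO_iff {P : Op Ω} : IsLODO (C : Set (Fun Ω)) P ↔ ∃ n, P ∈ opLT C n := by
  constructor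
  · rintro ⟨n, a, ha, rfl⟩
    exact ⟨n + 1, a, ha, rfl⟩
  · rintro ⟨n, hn⟩
    obtain ⟨a, ha, rfl⟩ := opLT_mono n.le_succ hn
    exact ⟨n, a, ha, rfl⟩

theorem mulOp_mul_mem_opLT {c : Fun Ω} (hc : c ∈ C) {n : ℕ} {P : Op Ω} (hP : P ∈ opLT C n) :
    mulOp Ω c * P ∈ opLT C n := by
  refine opLT_induction (H := (opLT C n).comap (AddMonoidHom.mulLeft (mulOp Ω c))) hP ?_
  intro a ha i hi
  change mulOp Ω c * (mulOp Ω a * Dx Ω ^ i) ∈ opLT C n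
  rw [← mul_assoc, ← map_mul]
  exact monomial_mem_opLT (C.mul_mem hc ha) hi

theorem Dx_mul_mem_opLT (hC : ∀ f ∈ C, Dx Ω f ∈ C) {n : ℕ} {P : Op Ω} (hP : P ∈ opLT C n) :
    Dx Ω * P ∈ opLT C (n + 1) := by
  refine opLT_induction (H := (opLT C (n + 1)).comap (AddMonoidHom.mulLeft (Dx Ω))) hP ?_
  intro a ha i hi
  change Dx Ω * (mulOp Ω a * Dx Ω ^ i) ∈ opLT C (n + 1)
  rw [← mul_assoc, Dx_mul_mulOp, add_mul, mul_assoc, ← pow_succ']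
  exact add_mem (monomial_mem_opLT ha (Nat.succ_lt_succ hi))
    (monomial_mem_opLT (hC a ha) (hi.trans n.lt_succ_self))

theorem Dx_pow_mul_mem_opLT (hC : ∀ f ∈ C, Dx Ω f ∈ C) {n : ℕ} {P : Op Ω} (hP : P ∈ opLT C n)
    (j : ℕ) : Dx Ω ^ j * P ∈ opLT C (n + j) := by
  induction j with
  | zero => simpa using hP
  | succ j ih =>
    rw [pow_succ', mul_assoc]
    exact Dx_mul_mem_opLT hC ih

/-- Moving derivatives past a coefficient creates only terms of lower order. This is what lets
leading terms cancel in the division. -/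
theorem Dx_pow_mul_monomial (hC : ∀ f ∈ C, Dx Ω f ∈ C) {a : Fun Ω} (ha : a ∈ C) (n j : ℕ) :
    Dx Ω ^ j * (mulOp Ω a * Dx Ω ^ n) - mulOp Ω a * Dx Ω ^ (n + j) ∈ opLT C (n + j) := by
  induction j with
  | zero => simp
  | succ j ih =>
    have h : Dx Ω ^ (j + 1) * (mulOp Ω a * Dx Ω ^ n) - mulOp Ω a * Dx Ω ^ (n + (j + 1)) =
        Dx Ω * (Dx Ω ^ j * (mulOp Ω a * Dx Ω ^ n) - mulOp Ω a * Dx Ω ^ (n + j)) +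
          mulOp Ω (Dx Ω a) * Dx Ω ^ (n + j) := by
      have h1 : Dx Ω * (mulOp Ω a * Dx Ω ^ (n + j)) =
          mulOp Ω a * Dx Ω ^ (n + (j + 1)) + mulOp Ω (Dx Ω a) * Dx Ω ^ (n + j) := by
        rw [← mul_assoc, Dx_mul_mulOp, add_mul, mul_assoc, ← pow_succ', add_assoc]
      rw [mul_sub, h1, pow_succ', mul_assoc]
      abel
    rw [h]
    exact add_mem (Dx_mul_mem_opLT hC ih) (monomial_mem_opLT (hC a ha) (Nat.lt_succ_self _))

theorem opLT_mul_mem (hC : ∀ f ∈ C, Dx Ω f ∈ C) {m n : ℕ} {P Q : Op Ω} (hP : P ∈ opLT C m)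
    (hQ : Q ∈ opLT C n) : P * Q ∈ opLT C (n + m) := by
  refine opLT_induction (H := (opLT C (n + m)).comap (AddMonoidHom.mulRight Q)) hP ?_
  intro a ha i hi
  change mulOp Ω a * Dx Ω ^ i * Q ∈ opLT C (n + m)
  rw [mul_assoc]
  exact mulOp_mul_mem_opLT ha (opLT_mono (by omega) (Dx_pow_mul_mem_opLT hC hQ i))

/-- The ring of differential operators with coefficients in `C`. -/
def opRing (C : Subring (Fun Ω)) (hC : ∀ f ∈ C, Dx Ω f ∈ C) : Subring (Op Ω) where
  carrier := {P | IsLODO (C : Set (Fun Ω)) P}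
  zero_mem' := isLODO_iff.2 ⟨0, zero_mem _⟩
  one_mem' := isLODO_iff.2 ⟨1, by simpa using monomial_mem_opLT C.one_mem zero_lt_one⟩
  add_mem' := by
    intro P Q hP hQ
    obtain ⟨m, hm⟩ := isLODO_iff.1 hP
    obtain ⟨n, hn⟩ := isLODO_iff.1 hQ
    exact isLODO_iff.2 ⟨max m n, add_mem (opLT_mono (le_max_left _ _) hm)
      (opLT_mono (le_max_right _ _) hn)⟩
  neg_mem' := by
    intro P hP
    obtain ⟨m, hm⟩ := isLODO_iff.1 hP
    exact isLODO_iff.2 ⟨m, neg_mem hm⟩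
  mul_mem' := by
    intro P Q hP hQ
    obtain ⟨m, hm⟩ := isLODO_iff.1 hP
    obtain ⟨n, hn⟩ := isLODO_iff.1 hQ
    exact isLODO_iff.2 ⟨_, opLT_mul_mem hC hm hn⟩

theorem mem_opRing {hC : ∀ f ∈ C, Dx Ω f ∈ C} {P : Op Ω} :
    P ∈ opRing C hC ↔ ∃ n, P ∈ opLT C n := isLODO_iff

theorem opLT_le_opRing {hC : ∀ f ∈ C, Dx Ω f ∈ C} {n : ℕ} {P : Op Ω} (h : P ∈ opLT C n) :
    P ∈ opRing C hC := mem_opRing.2 ⟨n, h⟩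

end opLT

theorem apply_mem_xFun {C : Subring (Fun Ω)} (hC : C ≤ xFun Ω) {P : Op Ω}
    (hP : IsLODO (C : Set (Fun Ω)) P) {f : Fun Ω} (hf : f ∈ xFun Ω) : P f ∈ xFun Ω := by
  obtain ⟨n, a, ha, rfl⟩ := hP
  have hD : ∀ i : ℕ, (Dx Ω ^ i) f ∈ xFun Ω := fun i => by
    induction i with
    | zero => simpa using hf
    | succ i ih =>
      rw [pow_succ']
      exact Dx_mem_xFun ih
  rw [op_sum_apply]
  exact sum_mem fun i _ => mul_mem (hC (ha i)) (hD i)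

/-! ### Operators are determined by their values on functions of `x` -/

theorem eq_zero_of_succ_nsmul {n : ℕ} {f : Fun Ω} (h : (n + 1) • f = 0) : f = 0 := by
  apply Subtype.ext
  have h1 : ((n + 1 : ℕ) : ℝ) • f.1 = 0 := by
    rw [Nat.cast_smul_eq_nsmul ℝ]
    simpa using congrArg Subtype.val h
  have h2 : ((n + 1 : ℕ) : ℝ) ≠ 0 := by positivity
  rw [← inv_smul_smul₀ h2 f.1, h1, smul_zero]
  rfl

theorem Dx_pow_xCoord_mul (i : ℕ) (f : Fun Ω) : (Dx Ω ^ (i + 1)) (xCoord Ω * f) =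
    xCoord Ω * (Dx Ω ^ (i + 1)) f + (i + 1) • (Dx Ω ^ i) f := by
  have h : ∀ g : Fun Ω, Dx Ω (xCoord Ω * g) = xCoord Ω * Dx Ω g + g := fun g => by
    have h1 := dirDeriv_mul Ω (1, 0) (xCoord Ω) g
    change Dx Ω _ = Dx Ω _ * g + _ * Dx Ω g at h1
    rw [h1, Dx_xCoord, one_mul, add_comm]
  induction i with
  | zero => simp [h]
  | succ i ih =>
    rw [pow_succ', op_mul_apply, ih, map_add, h, map_nsmul, succ_nsmul _ (i + 1),
      ← op_mul_apply (Dx Ω), ← op_mul_apply (Dx Ω), ← pow_succ', ← pow_succ']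
    abel

/-- The commutator of `∑ a_i D^i` with multiplication by x is `∑ i a_i D^(i-1)`. It also kills all
functions of x and is shorter, so induction removes every coefficient except `a_0`, which is tested
on the function 1. -/
theorem coeff_eq_zero_of_forall_xFun (n : ℕ) (a : ℕ → Fun Ω)
    (h : ∀ f ∈ xFun Ω, ∑ i ∈ Finset.range n, a i * (Dx Ω ^ i) f = 0) : ∀ i < n, a i = 0 := by
  induction n generalizing a with
  | zero => simp
  | succ n ih =>
    have h1 : ∀ i < n, (i + 1) • a (i + 1) = 0 := by
      refine ih (fun i => (i + 1) • a (i + 1)) fun f hf => ?_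
      have h2 := h _ (mul_mem (xCoord_mem Ω) hf)
      have h3 := h f hf
      rw [Finset.sum_range_succ'] at h2 h3
      simp only [Dx_pow_xCoord_mul, mul_add, Finset.sum_add_distrib] at h2
      have h4 : ∑ i ∈ Finset.range n, a (i + 1) * (xCoord Ω * (Dx Ω ^ (i + 1)) f) =
          xCoord Ω * ∑ i ∈ Finset.range n, a (i + 1) * (Dx Ω ^ (i + 1)) f := by
        rw [Finset.mul_sum]
        exact Finset.sum_congr rfl fun i _ => by ring
      have h5 : ∑ i ∈ Finset.range n, (i + 1) • a (i + 1) * (Dx Ω ^ i) f =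
          ∑ i ∈ Finset.range n, a (i + 1) * ((i + 1) • (Dx Ω ^ i) f) :=
        Finset.sum_congr rfl fun i _ => by rw [smul_mul_assoc, mul_smul_comm]
      rw [h5]
      rw [h4] at h2
      simp only [pow_zero, AddMonoid.End.coe_one, id_eq] at h2 h3
      linear_combination h2 - xCoord Ω * h3
    have h2 : ∀ i < n, a (i + 1) = 0 := fun i hi => eq_zero_of_succ_nsmul (h1 i hi)
    have h3 := h 1 (one_mem _)
    rw [Finset.sum_range_succ', Finset.sum_eq_zero (fun i hi => by
      rw [h2 i (Finset.mem_range.1 hi), zero_mul])] at h3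
    rintro (_ | i) hi
    · simpa using h3
    · exact h2 i (Nat.lt_of_succ_lt_succ hi)

theorem eq_of_eqOn_xFun {C : Subring (Fun Ω)} (hC : ∀ f ∈ C, Dx Ω f ∈ C) {P Q : Op Ω}
    (hP : IsLODO (C : Set (Fun Ω)) P) (hQ : IsLODO (C : Set (Fun Ω)) Q)
    (h : ∀ f ∈ xFun Ω, P f = Q f) : P = Q := by
  obtain ⟨n, a, ha, hPQ⟩ := (opRing C hC).sub_mem hP hQ
  have h1 := coeff_eq_zero_of_forall_xFun (n + 1) a fun f hf => by
    have h2 : (P - Q) f = 0 := by rw [op_sub_apply, h f hf, sub_self]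
    rw [hPQ, op_sum_apply] at h2
    exact h2
  refine sub_eq_zero.1 (hPQ.trans (Finset.sum_eq_zero fun i hi => ?_))
  rw [h1 i (Finset.mem_range.1 hi), map_zero, zero_mul]

/-! ### The field and its subfield of functions of `x` -/

theorem Dy_mul (f g : Fun Ω) : Dy Ω (f * g) = Dy Ω f * g + f * Dy Ω g := dirDeriv_mul _ _ _ _

namespace FunctionField

variable (K : FunctionField Ω)

/-- The elements of the field that depend on `x` only, as a ring. -/
def xRing : Subring (Fun Ω) := K.toSubring ⊓ xFun Ω

theorem coe_xRing : (K.xRing : Set (Fun Ω)) = K.xPart :=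
  Set.ext fun _ => and_congr Iff.rfl dependsOnX_iff.symm

theorem xRing_le : K.xRing ≤ K.toSubring := inf_le_left

theorem xRing_le_xFun : K.xRing ≤ xFun Ω := inf_le_right

theorem mem_xRing_of_dy {f : Fun Ω} (hf : f ∈ K.toSubring) (h : Dy Ω f = 0) : f ∈ K.xRing :=
  ⟨hf, dependsOnX_iff.1 (K.dependsOnX_of_dy_eq_zero f hf h)⟩

theorem dx_mem_toSubring : ∀ f ∈ K.toSubring, Dx Ω f ∈ K.toSubring := K.dx_mem

theorem dx_mem_xRing : ∀ f ∈ K.xRing, Dx Ω f ∈ K.xRing := fun f hf =>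
  ⟨K.dx_mem f hf.1, Dx_mem_xFun hf.2⟩

/-- Differentiating `a * b = 1` in y shows that the inverse taken in K has vanishing y-derivative.
-/
theorem exists_inv_xRing {a : Fun Ω} (ha : a ∈ K.xRing) (h0 : a ≠ 0) : ∃ b ∈ K.xRing, a * b = 1 := by
  obtain ⟨b, hb, hab⟩ := K.exists_inv a ha.1 h0
  refine ⟨b, K.mem_xRing_of_dy hb ?_, hab⟩
  have h1 : Dy Ω (a * b) = 0 := by rw [hab]; exact dirDeriv_one _ _
  rw [Dy_mul, Dy_of_mem_xFun ha.2, zero_mul, zero_add] at h1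
  calc Dy Ω b = b * (a * Dy Ω b) := by rw [← mul_assoc, mul_comm b, hab, one_mul]
    _ = 0 := by rw [h1, mul_zero]

/-- The ring of operators with coefficients depending on `x` only. -/
abbrev xOps : Subring (Op Ω) := opRing K.xRing K.dx_mem_xRing

/-- The ring of operators with coefficients in the field. -/
abbrev ops : Subring (Op Ω) := opRing K.toSubring K.dx_mem_toSubring

variable {K}

theorem mem_xOps {P : Op Ω} : P ∈ K.xOps ↔ IsLODO K.xPart P := by
  rw [← coe_xRing]
  exact Iff.rfl

theorem xOps_le_ops : K.xOps ≤ K.ops := by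
  rintro P ⟨n, a, ha, rfl⟩
  exact ⟨n, a, fun i => K.xRing_le (ha i), rfl⟩

theorem xOps_apply_mem {P : Op Ω} (hP : P ∈ K.xOps) {f : Fun Ω} (hf : f ∈ xFun Ω) :
    P f ∈ xFun Ω := apply_mem_xFun K.xRing_le_xFun hP hf

theorem ops_ext {P Q : Op Ω} (hP : P ∈ K.ops) (hQ : Q ∈ K.ops) (h : ∀ f ∈ xFun Ω, P f = Q f) :
    P = Q := eq_of_eqOn_xFun K.dx_mem_toSubring hP hQ h

/-! ### Division with remainder -/

/-- One more than the order of a nonzero operator; zero for the zero operator. -/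
def ord (K : FunctionField Ω) (P : Op Ω) : ℕ := sInf {n | P ∈ opLT K.xRing n}

theorem mem_opLT_ord {P : Op Ω} (hP : P ∈ K.xOps) : P ∈ opLT K.xRing (K.ord P) :=
  Nat.sInf_mem (s := {n | P ∈ opLT K.xRing n}) (mem_opRing.1 hP)

theorem ord_le {P : Op Ω} {n : ℕ} (h : P ∈ opLT K.xRing n) : K.ord P ≤ n := Nat.sInf_le h

theorem opLT_zero {C : Subring (Fun Ω)} {P : Op Ω} (h : P ∈ opLT C 0) : P = 0 := by
  obtain ⟨a, -, rfl⟩ := h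
  simp

theorem exists_leading {P : Op Ω} (hP : P ∈ K.xOps) (h0 : P ≠ 0) :
    ∃ n, K.ord P = n + 1 ∧ ∃ a ∈ K.xRing, a ≠ 0 ∧ ∃ Q ∈ opLT K.xRing n,
      P = mulOp Ω a * Dx Ω ^ n + Q := by
  obtain ⟨n, hn⟩ : ∃ n, K.ord P = n + 1 := Nat.exists_eq_succ_of_ne_zero fun h => by
    have h1 := mem_opLT_ord hP
    rw [h] at h1
    exact h0 (opLT_zero h1)
  have h1 := mem_opLT_ord hP
  rw [hn] at h1
  obtain ⟨a, ha, Q, hQ, rfl⟩ := mem_opLT_succ.1 h1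
  refine ⟨n, hn, a, ha, ?_, Q, hQ, rfl⟩
  rintro rfl
  rw [map_zero, zero_mul, zero_add] at hn
  have := ord_le hQ
  omega

theorem exists_div {P : Op Ω} (hP : P ∈ K.xOps) (h0 : P ≠ 0) {Q : Op Ω} (hQ : Q ∈ K.xOps) :
    ∃ S ∈ K.xOps, K.ord (Q - S * P) < K.ord P := by
  obtain ⟨n, hn, a, ha, ha0, P', hP', rfl⟩ := exists_leading hP h0
  suffices h : ∀ N, ∀ Q ∈ opLT K.xRing N,
      ∃ S ∈ K.xOps, Q - S * (mulOp Ω a * Dx Ω ^ n + P') ∈ opLT K.xRing n by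
    obtain ⟨N, hN⟩ := mem_opRing.1 hQ
    obtain ⟨S, hS, h⟩ := h N Q hN
    exact ⟨S, hS, by rw [hn]; exact Nat.lt_succ_of_le (ord_le h)⟩
  intro N
  induction N with
  | zero => exact fun Q hQ => ⟨0, zero_mem _, by simpa using opLT_mono (Nat.zero_le n) hQ⟩
  | succ N ih =>
    intro Q hQ
    rcases Nat.lt_or_ge N n with hNn | hNn
    · exact ⟨0, zero_mem _, by simpa using opLT_mono (Nat.succ_le_of_lt hNn) hQ⟩
    obtain ⟨j, rfl⟩ := Nat.exists_eq_add_of_le hNn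
    obtain ⟨b, hb, Q', hQ', rfl⟩ := mem_opLT_succ.1 hQ
    obtain ⟨a', ha', haa'⟩ := K.exists_inv_xRing ha ha0
    have hc : b * a' ∈ K.xRing := mul_mem hb ha'
    have hS₁ : mulOp Ω (b * a') * Dx Ω ^ j ∈ K.xOps :=
      opLT_le_opRing (monomial_mem_opLT hc j.lt_succ_self)
    -- The multiple `(b/a) D^j` of the divisor has the same leading term as the dividend, so the
    -- order drops.
    have hlow : mulOp Ω b * Dx Ω ^ (n + j) + Q' -
        mulOp Ω (b * a') * Dx Ω ^ j * (mulOp Ω a * Dx Ω ^ n + P') ∈ opLT K.xRing (n + j) := by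
      have h1 : mulOp Ω b = mulOp Ω (b * a') * mulOp Ω a := by
        rw [← map_mul, mul_assoc, mul_comm a', haa', mul_one]
      have h2 : mulOp Ω b * Dx Ω ^ (n + j) + Q' -
          mulOp Ω (b * a') * Dx Ω ^ j * (mulOp Ω a * Dx Ω ^ n + P') =
          Q' - mulOp Ω (b * a') * (Dx Ω ^ j * (mulOp Ω a * Dx Ω ^ n) -
            mulOp Ω a * Dx Ω ^ (n + j)) - mulOp Ω (b * a') * (Dx Ω ^ j * P') := by
        rw [h1]
        simp only [mul_add, mul_sub, mul_assoc]
        abel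
      rw [h2]
      exact sub_mem (sub_mem hQ' (mulOp_mul_mem_opLT hc
        (Dx_pow_mul_monomial K.dx_mem_xRing ha n j)))
        (mulOp_mul_mem_opLT hc (Dx_pow_mul_mem_opLT K.dx_mem_xRing hP' j))
    obtain ⟨S₂, hS₂, h3⟩ := ih _ hlow
    refine ⟨mulOp Ω (b * a') * Dx Ω ^ j + S₂, add_mem hS₁ hS₂, ?_⟩
    rwa [add_mul, ← sub_sub]

/-- A non-zero element of least order generates a left ideal, by division. The gain is
Noetherianity, which supplies the rank condition and the equivalence of one-sided inverses for
square matrices. -/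
instance : IsPrincipalIdealRing K.xOps where
  principal I := by
    by_cases hI : I = ⊥
    · rw [hI]
      exact ⟨0, by simp⟩
    obtain ⟨P₀, hP₀, hP₀0⟩ := Submodule.exists_mem_ne_zero_of_ne_bot hI
    obtain ⟨P, ⟨hPI, hP0⟩, hmin⟩ := exists_minimalFor_of_wellFoundedLT
      (fun P : K.xOps => P ∈ I ∧ P ≠ 0) (fun P => K.ord P.1) ⟨P₀, hP₀, hP₀0⟩
    refine ⟨P, le_antisymm (fun Q hQ => ?_) ((Submodule.span_singleton_le_iff_mem _ _).2 hPI)⟩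
    obtain ⟨S, hS, hlt⟩ := exists_div P.2 (fun h => hP0 (Subtype.ext h)) Q.2
    have hmem : Q - ⟨S, hS⟩ * P ∈ I := sub_mem hQ (I.mul_mem_left _ hPI)
    have hz : Q - ⟨S, hS⟩ * P = 0 := by
      by_contra hne
      have h1 : K.ord P.1 ≤ K.ord (Q.1 - S * P.1) := hmin ⟨hmem, hne⟩ hlt.le
      omega
    rw [sub_eq_zero.1 hz]
    exact Submodule.mem_span_singleton.2 ⟨_, rfl⟩

/-! ### One-sided inverses of operator matrices -/

theorem exists_lift {p q : ℕ} {R : Matrix (Fin p) (Fin q) (Op Ω)} (hR : ∀ i j, R i j ∈ K.xOps) :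
    ∃ R' : Matrix (Fin p) (Fin q) K.xOps, R'.map K.xOps.subtype = R :=
  ⟨fun i j => ⟨R i j, hR i j⟩, rfl⟩

/-- A `p × q` matrix with a left inverse is invertible as soon as `p ≤ q`, and then `p = q`. -/
theorem eq_and_mul_eq_one [Nontrivial (Fun Ω)] {p q : ℕ} {R : Matrix (Fin p) (Fin q) (Op Ω)}
    {W : Matrix (Fin q) (Fin p) (Op Ω)} (hR : ∀ i j, R i j ∈ K.xOps) (hW : ∀ i j, W i j ∈ K.xOps)
    (h : W * R = 1) (hpq : p ≤ q) : p = q ∧ R * W = 1 := by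
  obtain ⟨R, rfl⟩ := exists_lift hR
  obtain ⟨W, rfl⟩ := exists_lift hW
  have hinj : Function.Injective K.xOps.subtype := Subtype.val_injective
  have h' : W * R = 1 := by
    apply Matrix.map_injective hinj
    change (W * R).map K.xOps.subtype = (1 : Matrix _ _ _).map K.xOps.subtype
    rw [Matrix.map_mul, h, Matrix.map_one _ (map_zero _) (map_one _)]
  have hnt : Nontrivial (Op Ω) := ⟨0, 1, fun h => by
    obtain ⟨f, hf⟩ := exists_ne (0 : Fun Ω)
    exact hf (DFunLike.congr_fun h f).symm⟩
  have hnt' : Nontrivial K.xOps := inferInstance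
  have hpq' : p = q := hpq.antisymm (rankCondition_iff_matrix.1 inferInstance _ _ _ _ h')
  subst hpq'
  refine ⟨rfl, ?_⟩
  rw [← Matrix.map_mul, mul_eq_one_comm.1 h', Matrix.map_one _ (map_zero _) (map_one _)]

/-! ### Solvability in functions of `x` -/

/-- Scalar linear differential equations are solvable in functions of `x`. -/
theorem exists_solution {P : Op Ω} (hP : P ∈ K.xOps) (h0 : P ≠ 0) {g : Fun Ω} (hg : g ∈ xFun Ω) :
    ∃ f ∈ xFun Ω, P f = g := by
  obtain ⟨n, -, a, ha, ha0, Q, ⟨c, hc, rfl⟩, rfl⟩ := exists_leading hP h0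
  obtain ⟨b, hb, hab⟩ := K.exists_inv_xRing ha ha0
  rcases n with _ | n
  · refine ⟨b * g, mul_mem hb.2 hg, ?_⟩
    simp only [Finset.range_zero, Finset.sum_empty, add_zero, pow_zero, mul_one, mulOp_apply]
    rw [← mul_assoc, hab, one_mul]
  have hc' : ∀ i, b * c i ∈ xFun Ω := fun i => mul_mem hb.2 (hc i).2
  choose γ hγ using hc'
  obtain ⟨η, hη⟩ : b * g ∈ xFun Ω := mul_mem hb.2 hg
  -- Companion system of the equation divided by its leading coefficient: each unknown is the
  -- derivative of the previous one, and the last row is the equation itself.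
  obtain ⟨y, hy⟩ := exists_solution_system (J := xProj Ω) (n := n + 1)
    (fun i j => if i = Fin.last n then -γ j else if (j : ℕ) = i + 1 then 1 else 0)
    (fun i => if i = Fin.last n then η else 0)
  have hstep : ∀ (i : ℕ) (hi : i < n), Dx Ω (pull Ω (y ⟨i, by omega⟩)) =
      pull Ω (y ⟨i + 1, by omega⟩) := by
    intro i hi
    have hne : (⟨i, by omega⟩ : Fin (n + 1)) ≠ Fin.last n := by
      intro h
      have := congrArg Fin.val h
      simp at this
      omega
    rw [Dx_pull, hy]
    congr 1
    simp only [if_neg hne, add_zero]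
    rw [Finset.sum_eq_single ⟨i + 1, by omega⟩]
    · simp
    · intro j _ hj
      rw [if_neg (fun h => hj (Fin.ext h)), zero_mul]
    · simp
  have hpow : ∀ (i : ℕ) (hi : i < n + 1), (Dx Ω ^ i) (pull Ω (y 0)) = pull Ω (y ⟨i, hi⟩) := by
    intro i
    induction i with
    | zero => intro _; rfl
    | succ i ih =>
      intro hi
      rw [pow_succ', op_mul_apply, ih (by omega), hstep i (by omega)]
  have htop : (Dx Ω ^ (n + 1)) (pull Ω (y 0)) =
      b * g - ∑ i ∈ Finset.range (n + 1), b * c i * (Dx Ω ^ i) (pull Ω (y 0)) := by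
    rw [pow_succ', op_mul_apply, hpow n (by omega), Dx_pull, hy, Finset.sum_range]
    simp only [Fin.last, if_true, map_add, map_sum, map_mul, map_neg, hγ, hη]
    simp only [hpow _ (Fin.is_lt _), Fin.eta, neg_mul, Finset.sum_neg_distrib]
    ring
  refine ⟨pull Ω (y 0), ⟨_, rfl⟩, ?_⟩
  rw [op_add_apply, op_sum_apply, op_mul_apply, htop, mulOp_apply, mul_sub, ← mul_assoc, hab,
    one_mul, Finset.mul_sum, sub_add, sub_eq_self, sub_eq_zero]
  refine Finset.sum_congr rfl fun i _ => ?_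
  rw [op_mul_apply, mulOp_apply, ← mul_assoc, ← mul_assoc, hab, one_mul]

/-! ### Linear independence over functions of `x` -/

/-- Elements of the field that are independent over its subfield of functions of `x` are
independent over all functions of `x`. -/
theorem indep_xFun {ι : Type*} (s : Finset ι) (e : ι → Fun Ω) (he : ∀ i ∈ s, e i ∈ K.toSubring)
    (hind : ∀ c : ι → Fun Ω, (∀ i, c i ∈ K.xRing) → ∑ i ∈ s, c i * e i = 0 → ∀ i ∈ s, c i = 0)
    (f : ι → Fun Ω) (hf : ∀ i, f i ∈ xFun Ω) (h : ∑ i ∈ s, f i * e i = 0) : ∀ i ∈ s, f i = 0 := by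
  classical
  induction s using Finset.cons_induction generalizing e with
  | empty => simp
  | cons j s hj ih =>
    have hne : ∀ i ∈ s, i ≠ j := fun i hi h => hj (h ▸ hi)
    have hupd : ∀ (c : ι → Fun Ω) (d : Fun Ω), ∑ i ∈ Finset.cons j s hj,
        Function.update c j d i * e i = d * e j + ∑ i ∈ s, c i * e i := by
      intro c d
      rw [Finset.sum_cons, Function.update_self]
      congr 1
      exact Finset.sum_congr rfl fun i hi => by rw [Function.update_of_ne (hne i hi)]
    have hmem : ∀ (c : ι → Fun Ω) (d : Fun Ω), (∀ i, c i ∈ K.xRing) → d ∈ K.xRing →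
        ∀ i, Function.update c j d i ∈ K.xRing := by
      intro c d hc hd i
      rcases eq_or_ne i j with rfl | hij
      · rwa [Function.update_self]
      · rw [Function.update_of_ne hij]
        exact hc i
    -- A zero member of an independent family forces 1 = 0, and then everything vanishes.
    by_cases hej : e j = 0
    · have h2 := hind (Function.update (fun _ => 0) j 1)
        (hmem _ _ (fun _ => zero_mem _) (one_mem _)) (by rw [hupd, hej]; simp) j
        (Finset.mem_cons_self j s)
      rw [Function.update_self] at h2
      intro i _
      rw [← one_mul (f i), h2, zero_mul]
    obtain ⟨u, hu, hju⟩ := K.exists_inv (e j) (he j (Finset.mem_cons_self j s)) hej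
    have hue : ∀ i ∈ s, u * e i ∈ K.toSubring := fun i hi =>
      mul_mem hu (he i (Finset.mem_cons_of_mem hi))
    have hDy : ∀ c : ι → Fun Ω, (∀ i, c i ∈ xFun Ω) →
        ∑ i ∈ s, c i * Dy Ω (u * e i) = Dy Ω (u * ∑ i ∈ s, c i * e i) := by
      intro c hc
      rw [Finset.mul_sum, map_sum]
      refine Finset.sum_congr rfl fun i _ => ?_
      rw [mul_left_comm u, Dy_mul (c i), Dy_of_mem_xFun (hc i), zero_mul, zero_add]
    have hs : ∀ i ∈ s, f i = 0 := by
      -- Dividing the relation by `e j` and differentiating in y eliminates the term with index j.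
      -- The shorter family is still independent: if `∑ c_i ∂_y(u e_i) = 0`, then `u ∑ c_i e_i` lies
      -- in K_x, which gives a relation among the original elements.
      refine ih (fun i => Dy Ω (u * e i)) (fun i hi => K.dy_mem _ (hue i hi)) (fun c hc h0 => ?_) ?_
      · rw [hDy c fun i => (hc i).2] at h0
        have hd : u * ∑ i ∈ s, c i * e i ∈ K.xRing := K.mem_xRing_of_dy (by
          rw [Finset.mul_sum]
          refine sum_mem fun i hi => ?_
          rw [mul_left_comm]
          exact mul_mem (hc i).1 (hue i hi)) h0
        have h3 := hind (Function.update c j (-(u * ∑ i ∈ s, c i * e i)))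
          (hmem _ _ hc (neg_mem hd)) (by
            rw [hupd]
            linear_combination (-∑ i ∈ s, c i * e i) * hju)
        intro i hi
        have h4 := h3 i (Finset.mem_cons_of_mem hi)
        rwa [Function.update_of_ne (hne i hi)] at h4
      · rw [hDy f hf]
        rw [Finset.sum_cons] at h
        have h1 : u * ∑ i ∈ s, f i * e i = -f j := by
          linear_combination u * h - f j * hju
        rw [h1, map_neg, Dy_of_mem_xFun (hf j), neg_zero]
    intro i hi
    rcases Finset.mem_cons.1 hi with rfl | hi
    · rw [Finset.sum_cons, Finset.sum_eq_zero fun k hk => by rw [hs k hk, zero_mul], add_zero] at h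
      rw [← mul_one (f i), ← hju, ← mul_assoc, h, zero_mul]
    · exact hs i hi

theorem isField_xRing [Nontrivial (Fun Ω)] : IsField K.xRing where
  exists_pair_ne := ⟨0, 1, fun h => zero_ne_one' (Fun Ω) (congrArg Subtype.val h)⟩
  mul_comm := mul_comm
  mul_inv_cancel {a} ha := by
    obtain ⟨b, hb, hab⟩ := K.exists_inv_xRing a.2 fun h => ha (Subtype.ext h)
    exact ⟨⟨b, hb⟩, Subtype.ext hab⟩

variable (K) in
/-- The field has a basis over its subfield of functions of `x`. -/
theorem exists_basis [Nontrivial (Fun Ω)] : ∃ (ι : Type) (e : ι → Fun Ω),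
    (∀ i, e i ∈ K.toSubring) ∧
    (∀ (s : Finset ι) (c : ι → Fun Ω), (∀ i, c i ∈ K.xRing) → ∑ i ∈ s, c i * e i = 0 →
      ∀ i ∈ s, c i = 0) ∧
    ∀ f ∈ K.toSubring, ∃ (s : Finset ι) (c : ι → Fun Ω), (∀ i, c i ∈ K.xRing) ∧
      f = ∑ i ∈ s, c i * e i := by
  let _ : Field K.xRing := isField_xRing.toField
  let M : Submodule K.xRing (Fun Ω) :=
    { K.toSubring.toAddSubgroup with
      smul_mem' := fun c _ hx => mul_mem (K.xRing_le c.2) hx }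
  let b := Module.Basis.ofVectorSpace K.xRing M
  refine ⟨_, fun i => (b i : Fun Ω), fun i => (b i).2, fun s c hc h => ?_, fun f hf => ?_⟩
  · have h1 := linearIndependent_iff'.1 b.linearIndependent s (fun i => ⟨c i, hc i⟩) (by
      apply Subtype.ext
      rw [Submodule.coe_sum]
      exact h)
    exact fun i hi => congrArg Subtype.val (h1 i hi)
  · refine ⟨(b.repr ⟨f, hf⟩).support, fun i => (b.repr ⟨f, hf⟩ i : Fun Ω),
      fun i => (b.repr ⟨f, hf⟩ i).2, ?_⟩
    have h1 := congrArg (Subtype.val : M → Fun Ω) (b.linearCombination_repr ⟨f, hf⟩)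
    rw [Finsupp.linearCombination_apply, Finsupp.sum, Submodule.coe_sum] at h1
    exact h1.symm

end FunctionField

/-! ### Row reduction -/

theorem RowReduces.trans {C : Set (Fun Ω)} {p k : ℕ} {A B B' : Matrix (Fin p) (Fin k) (Op Ω)}
    (h₁ : RowReduces C A B) (h₂ : RowReduces C B B') : RowReduces C A B' := by
  induction h₂ with
  | refl => exact h₁
  | swap B i j _ ih => exact .swap B i j ih
  | add B i j hij T hT _ ih => exact .add B i j hij T hT ih

namespace FunctionField

variable {K : FunctionField Ω}

/-- The entries of the matrix are operators with coefficients depending on `x` only. -/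
def XMat (K : FunctionField Ω) {m n : Type*} (R : Matrix m n (Op Ω)) : Prop :=
  ∀ i j, R i j ∈ K.xOps

theorem xMat_iff {p k : ℕ} {R : Matrix (Fin p) (Fin k) (Op Ω)} :
    K.XMat R ↔ MatOver K.xPart R :=
  forall_congr' fun _ => forall_congr' fun _ => mem_xOps

theorem XMat.mul {l m n : Type*} [Fintype m] {A : Matrix l m (Op Ω)} {B : Matrix m n (Op Ω)}
    (hA : K.XMat A) (hB : K.XMat B) : K.XMat (A * B) := fun i j =>
  sum_mem fun a _ => mul_mem (hA i a) (hB a j)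

theorem xMat_one {n : Type*} [DecidableEq n] : K.XMat (1 : Matrix n n (Op Ω)) := fun i j => by
  rw [Matrix.one_apply]
  split_ifs
  exacts [one_mem _, zero_mem _]

theorem matInvertible_iff {p k : ℕ} {R : Matrix (Fin p) (Fin k) (Op Ω)} :
    MatInvertible K.xPart R ↔ ∃ S : Matrix (Fin k) (Fin p) (Op Ω), K.XMat S ∧ R * S = 1 ∧ S * R = 1 :=
  exists_congr fun _ => and_congr xMat_iff.symm Iff.rfl

/-- Row operations are left multiplication by an invertible matrix. -/
theorem exists_eq_mul_of_rowReduces {p k : ℕ} {A B : Matrix (Fin p) (Fin k) (Op Ω)}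
    (h : RowReduces K.xPart A B) : ∃ U V : Matrix (Fin p) (Fin p) (Op Ω),
      K.XMat U ∧ K.XMat V ∧ U * V = 1 ∧ V * U = 1 ∧ B = U * A := by
  induction h with
  | refl => exact ⟨1, 1, xMat_one, xMat_one, by simp, by simp, by simp⟩
  | swap B i j _ ih =>
    obtain ⟨U, V, hU, hV, h1, h2, rfl⟩ := ih
    refine ⟨U.submatrix (Equiv.swap i j) id, V.submatrix id (Equiv.swap i j),
      fun a b => hU _ _, fun a b => hV _ _, ?_, ?_, ?_⟩
    · rw [← Matrix.submatrix_mul _ _ _ id _ Function.bijective_id, h1, Matrix.submatrix_one_equiv]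
    · rw [Matrix.submatrix_mul_equiv, h2, Matrix.submatrix_id_id]
    · rw [← Matrix.submatrix_id_id A, ← Matrix.submatrix_mul _ _ _ id _ Function.bijective_id,
        Matrix.submatrix_id_id]
  | add B i j hij T hT _ ih =>
    obtain ⟨U, V, hU, hV, h1, h2, rfl⟩ := ih
    have hT' := mem_xOps.2 hT
    -- The operation is multiplication by an elementary matrix, whose inverse has `-T` in place of
    -- `T` because i ≠ j.
    have hsing : ∀ T ∈ K.xOps, K.XMat (1 + Matrix.single i j T) := fun T hT a b => by
      refine add_mem (xMat_one a b) ?_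
      rw [Matrix.single_apply]
      split_ifs
      exacts [hT, zero_mem _]
    have hinv : ∀ T T' : Op Ω, T + T' = 0 →
        (1 + Matrix.single i j T) * (1 + Matrix.single i j T') = 1 := by
      intro T T' h
      rw [add_mul, mul_add, mul_add, Matrix.single_mul_single_of_ne _ _ _ _ hij.symm, one_mul,
        one_mul, mul_one, add_zero, add_assoc, ← Matrix.single_add, add_comm T', h,
        Matrix.single_zero, add_zero]
    refine ⟨(1 + Matrix.single i j T) * U, V * (1 + Matrix.single i j (-T)),
      (hsing _ hT').mul hU, hV.mul (hsing _ (neg_mem hT')), ?_, ?_, ?_⟩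
    · rw [Matrix.mul_assoc, ← Matrix.mul_assoc U, h1, Matrix.one_mul, hinv _ _ (add_neg_cancel T)]
    · rw [Matrix.mul_assoc, ← Matrix.mul_assoc _ _ U, hinv _ _ (neg_add_cancel T), Matrix.one_mul, h2]
    · rw [Matrix.mul_assoc, Matrix.add_mul, Matrix.one_mul]
      ext1 a b
      rw [Matrix.add_apply]
      rcases eq_or_ne a i with rfl | ha
      · rw [Matrix.updateRow_self, Matrix.single_mul_apply_same]
      · rw [Matrix.updateRow_ne ha, Matrix.single_mul_apply_of_ne _ _ _ _ _ ha, add_zero]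

theorem xMat_of_rowReduces {p k : ℕ} {A B : Matrix (Fin p) (Fin k) (Op Ω)} (hA : K.XMat A)
    (h : RowReduces K.xPart A B) : K.XMat B := by
  obtain ⟨U, V, hU, -, -, -, rfl⟩ := exists_eq_mul_of_rowReduces h
  exact hU.mul hA

/-- By operations on the rows from `r` on, a column is brought to zero below row `r`. -/
theorem exists_clear_column {p k : ℕ} (r : Fin p) (c : Fin k) (B : Matrix (Fin p) (Fin k) (Op Ω))
    (hB : K.XMat B) : ∃ B', RowReduces K.xPart B B' ∧ (∀ i < r, ∀ j, B' i j = B i j) ∧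
      (∀ i, r < i → B' i c = 0) ∧
      ∀ j, (∀ i, r ≤ i → B i j = 0) → ∀ i, r ≤ i → B' i j = 0 := by
  induction hN : ∑ i ∈ Finset.Ici r, K.ord (B i c) using Nat.strong_induction_on generalizing B with
  | _ N ih =>
    subst hN
    -- Euclidean algorithm in the column: while one entry can be divided by another, the sum of
    -- orders decreases. Otherwise at most one entry is non-zero, and a swap brings it to row r.
    by_cases hex : ∃ i j, r ≤ i ∧ r ≤ j ∧ i ≠ j ∧ B j c ≠ 0 ∧ K.ord (B j c) ≤ K.ord (B i c)
    · obtain ⟨i, j, hi, hj, hij, hj0, hle⟩ := hex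
      by_cases hi0 : B i c = 0
      · exfalso
        obtain ⟨n, hn, -⟩ := exists_leading (hB j c) hj0
        have h0 : K.ord (B i c) ≤ 0 := ord_le (by rw [hi0]; exact zero_mem _)
        omega
      obtain ⟨S, hS, hlt⟩ := exists_div (hB j c) hj0 (hB i c)
      set B₁ := B.updateRow i fun b => B i b + -S * B j b with hB₁
      have hred : RowReduces K.xPart B B₁ := .add B i j hij (-S) (mem_xOps.1 (neg_mem hS)) .refl
      have hne : ∀ a, a ≠ i → ∀ b, B₁ a b = B a b := fun a ha b => by
        rw [hB₁, Matrix.updateRow_ne ha]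
      have hself : ∀ b, B₁ i b = B i b - S * B j b := fun b => by
        rw [hB₁, Matrix.updateRow_self, sub_eq_add_neg]
        congr 1
      obtain ⟨B', h1, h2, h3, h4⟩ := ih _ (by
        refine Finset.sum_lt_sum (fun a _ => ?_) ⟨i, Finset.mem_Ici.2 hi, ?_⟩
        · rcases eq_or_ne a i with rfl | ha
          · rw [hself]; omega
          · rw [hne a ha]
        · rw [hself]; omega) B₁ (xMat_of_rowReduces hB hred) rfl
      refine ⟨B', hred.trans h1, fun a ha b => ?_, h3, fun b hb => h4 b fun a ha => ?_⟩
      · rw [h2 a ha, hne a (fun h => absurd (h ▸ ha) (not_lt.2 hi))]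
      · rcases eq_or_ne a i with rfl | hai
        · rw [hself, hb _ hi, hb j hj, mul_zero, sub_zero]
        · rw [hne a hai, hb a ha]
    have huniq : ∀ i j, r ≤ i → r ≤ j → B i c ≠ 0 → B j c ≠ 0 → i = j := by
      intro i j hi hj hi0 hj0
      by_contra hij
      rcases le_total (K.ord (B j c)) (K.ord (B i c)) with h | h
      · exact hex ⟨i, j, hi, hj, hij, hj0, h⟩
      · exact hex ⟨j, i, hj, hi, Ne.symm hij, hi0, h⟩
    by_cases hz : ∃ i, r ≤ i ∧ B i c ≠ 0
    · obtain ⟨i, hi, hi0⟩ := hz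
      have hge : ∀ a, r ≤ a → r ≤ Equiv.swap r i a := by
        intro a ha
        rw [Equiv.swap_apply_def]
        split_ifs
        exacts [hi, le_rfl, ha]
      refine ⟨_, .swap B r i .refl, fun a ha b => ?_, fun a ha => ?_, fun b hb a ha => ?_⟩
      · rw [Matrix.submatrix_apply, Equiv.swap_apply_of_ne_of_ne ha.ne (ha.trans_le hi).ne]
        rfl
      · rw [Matrix.submatrix_apply]
        by_contra h0
        have h1 := huniq _ _ (hge a ha.le) hi h0 hi0
        rw [Equiv.swap_apply_eq_iff, Equiv.swap_apply_right] at h1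
        exact ha.ne' h1
      · exact hb _ (hge a ha)
    · push Not at hz
      exact ⟨B, .refl, fun _ _ _ => rfl, fun i hi => hz i hi.le, fun j hj => hj⟩

/-- Every operator matrix can be brought to echelon form by row operations. -/
theorem exists_echelon {p k : ℕ} (A : Matrix (Fin p) (Fin k) (Op Ω)) (hA : K.XMat A) :
    ∃ B r, RowReduces K.xPart A B ∧ IsEchelon B r := by
  -- Invariant after treating c columns. Pivots are recorded by a total function on ℕ, whose values
  -- from r on are irrelevant, so that a new pivot is added by `Function.update`.
  suffices h : ∀ c ≤ k, ∃ (B : Matrix (Fin p) (Fin k) (Op Ω)) (r : ℕ) (q : ℕ → ℕ),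
      RowReduces K.xPart A B ∧ r ≤ p ∧ (∀ i < r, q i < c) ∧ (∀ i j, i < j → j < r → q i < q j) ∧
      (∀ i : Fin p, (i : ℕ) < r → (∀ j : Fin k, (j : ℕ) = q i → B i j ≠ 0) ∧
        ∀ j : Fin k, (j : ℕ) < q i → B i j = 0) ∧
      ∀ i : Fin p, r ≤ (i : ℕ) → ∀ j : Fin k, (j : ℕ) < c → B i j = 0 by
    obtain ⟨B, r, q, h1, h2, h3, h4, h5, h6⟩ := h k le_rfl
    refine ⟨B, r, h1, h2, fun i => ⟨q i, h3 i i.2⟩, fun i j hij => h4 i j hij j.2,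
      fun i => ⟨(h5 (Fin.castLE h2 i) i.2).1 _ rfl, fun j hj => (h5 (Fin.castLE h2 i) i.2).2 j hj⟩,
      fun i hi j => h6 i hi j j.2⟩
  intro c
  induction c with
  | zero =>
    exact fun _ => ⟨A, 0, id, .refl, Nat.zero_le _, by simp, by simp, by simp, by simp⟩
  | succ c ih =>
    intro hc
    obtain ⟨B, r, q, h1, h2, h3, h4, h5, h6⟩ := ih (by omega)
    rcases h2.eq_or_lt with rfl | hrp
    · exact ⟨B, r, q, h1, h2, fun i hi => (h3 i hi).trans c.lt_succ_self, h4, h5,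
        fun i hi => absurd i.2 (by omega)⟩
    obtain ⟨B', h1', heq, hbelow, hz⟩ :=
      exists_clear_column ⟨r, hrp⟩ ⟨c, hc⟩ B (xMat_of_rowReduces hA h1)
    have h5' : ∀ i : Fin p, (i : ℕ) < r → (∀ j : Fin k, (j : ℕ) = q i → B' i j ≠ 0) ∧
        ∀ j : Fin k, (j : ℕ) < q i → B' i j = 0 := by
      intro i hi
      simp only [heq i hi]
      exact h5 i hi
    have h6' : ∀ i : Fin p, r ≤ (i : ℕ) → ∀ j : Fin k, (j : ℕ) < c → B' i j = 0 :=
      fun i hi j hj => hz j (fun a ha => h6 a ha j hj) i hi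
    by_cases h0 : B' ⟨r, hrp⟩ ⟨c, hc⟩ = 0
    · refine ⟨B', r, q, h1.trans h1', h2, fun i hi => (h3 i hi).trans c.lt_succ_self, h4, h5',
        fun i hi j hj => ?_⟩
      rcases (Nat.lt_succ_iff.1 hj).lt_or_eq with hj | hj
      · exact h6' i hi j hj
      · obtain rfl : j = ⟨c, hc⟩ := Fin.ext hj
        rcases hi.lt_or_eq with hi | hi
        · exact hbelow i hi
        · obtain rfl : i = ⟨r, hrp⟩ := Fin.ext hi.symm
          exact h0
    · have hqr : Function.update q r c r = c := Function.update_self ..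
      have hqi : ∀ i, i < r → Function.update q r c i = q i := fun i hi =>
        Function.update_of_ne hi.ne ..
      refine ⟨B', r + 1, Function.update q r c, h1.trans h1', hrp, fun i hi => ?_,
        fun i j hij hj => ?_, fun i hi => ?_, fun i hi j hj => ?_⟩
      · rcases (Nat.lt_succ_iff.1 hi).lt_or_eq with hi | rfl
        · rw [hqi i hi]
          exact (h3 i hi).trans c.lt_succ_self
        · rw [hqr]
          exact c.lt_succ_self
      · rcases (Nat.lt_succ_iff.1 hj).lt_or_eq with hj | rfl
        · rw [hqi j hj, hqi i (hij.trans hj)]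
          exact h4 i j hij hj
        · rw [hqr, hqi i hij]
          exact h3 i hij
      · rcases (Nat.lt_succ_iff.1 hi).lt_or_eq with hi | hi
        · rw [hqi i hi]
          exact h5' i hi
        · obtain rfl : i = ⟨r, hrp⟩ := Fin.ext hi
          dsimp only
          rw [hqr]
          refine ⟨fun j hj => ?_, h6' _ le_rfl⟩
          obtain rfl : j = ⟨c, hc⟩ := Fin.ext hj
          exact h0
      · rcases (Nat.lt_succ_iff.1 hj).lt_or_eq with hj | hj
        · exact h6' i (by omega) j hj
        · obtain rfl : j = ⟨c, hc⟩ := Fin.ext hj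
          exact hbelow i hi

/-! ### Operator matrices acting on columns of functions -/

/-- The column obtained by applying an operator matrix to a column of functions. -/
def act {m n : Type*} [Fintype n] (R : Matrix m n (Op Ω)) (φ : n → Fun Ω) (i : m) : Fun Ω :=
  ∑ j, R i j (φ j)

/-- The function obtained by applying an operator row to a column of functions. -/
def rowAct {n : Type*} [Fintype n] (L : n → Op Ω) (φ : n → Fun Ω) : Fun Ω := ∑ j, L j (φ j)

theorem rowAct_vecMul {m n : Type*} [Fintype m] [Fintype n] (L : m → Op Ω)
    (R : Matrix m n (Op Ω)) (φ : n → Fun Ω) : rowAct (L ᵥ* R) φ = rowAct L (act R φ) := by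
  have h : ∀ j, (L ᵥ* R) j (φ j) = ∑ i, L i (R i j (φ j)) := fun j => op_sum_apply _ _ _
  simp only [rowAct, act, h, map_sum]
  exact Finset.sum_comm

theorem act_mul {l m n : Type*} [Fintype m] [Fintype n] (A : Matrix l m (Op Ω))
    (B : Matrix m n (Op Ω)) (φ : n → Fun Ω) : act (A * B) φ = act A (act B φ) :=
  funext fun i => rowAct_vecMul (A i) B φ

theorem act_one {n : Type*} [Fintype n] [DecidableEq n] (φ : n → Fun Ω) :
    act (1 : Matrix n n (Op Ω)) φ = φ := by
  funext i
  rw [act, Finset.sum_eq_single i]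
  · rw [Matrix.one_apply_eq]
    rfl
  · intro j _ hj
    rw [Matrix.one_apply_ne hj.symm]
    rfl
  · simp

theorem rowAct_single {n : Type*} [Fintype n] [DecidableEq n] (L : n → Op Ω) (j : n) (f : Fun Ω) :
    rowAct L (Pi.single j f) = L j f := by
  rw [rowAct, Finset.sum_eq_single j, Pi.single_eq_same]
  · intro b _ hb
    rw [Pi.single_eq_of_ne hb, map_zero]
  · simp

theorem single_mem_xFun {n : Type*} [DecidableEq n] {j : n} {f : Fun Ω} (hf : f ∈ xFun Ω) (b : n) :
    (Pi.single j f : n → Fun Ω) b ∈ xFun Ω := by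
  rcases eq_or_ne b j with rfl | hb
  · rwa [Pi.single_eq_same]
  · rw [Pi.single_eq_of_ne hb]
    exact zero_mem _

theorem act_mem {m n : Type*} [Fintype n] {R : Matrix m n (Op Ω)} (hR : K.XMat R) {φ : n → Fun Ω}
    (hφ : ∀ j, φ j ∈ xFun Ω) (i : m) : act R φ i ∈ xFun Ω :=
  sum_mem fun j _ => xOps_apply_mem (hR i j) (hφ j)

theorem mem_stock {k : ℕ} {L : Fin k → Op Ω} {F : Fun Ω} :
    F ∈ stock L ↔ ∃ φ : Fin k → Fun Ω, (∀ i, φ i ∈ xFun Ω) ∧ F = rowAct L φ :=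
  exists_congr fun _ => and_congr (forall_congr' fun _ => dependsOnX_iff) Iff.rfl

/-- The matrix maps columns of functions of `x` onto all columns of functions of `x`. -/
def XSurj {m n : Type*} [Fintype n] (R : Matrix m n (Op Ω)) : Prop :=
  ∀ g : m → Fun Ω, (∀ i, g i ∈ xFun Ω) → ∃ φ : n → Fun Ω, (∀ j, φ j ∈ xFun Ω) ∧ act R φ = g

theorem XSurj.mul {l m n : Type*} [Fintype m] [Fintype n] {A : Matrix l m (Op Ω)}
    {B : Matrix m n (Op Ω)} (hA : XSurj A) (hB : XSurj B) : XSurj (A * B) := by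
  intro g hg
  obtain ⟨φ, hφ, rfl⟩ := hA g hg
  obtain ⟨ψ, hψ, rfl⟩ := hB φ hφ
  exact ⟨ψ, hψ, act_mul A B ψ⟩

theorem XSurj.of_mul_eq_one {m n : Type*} [Fintype m] [Fintype n] [DecidableEq m]
    {A : Matrix m n (Op Ω)} {B : Matrix n m (Op Ω)} (hB : K.XMat B) (h : A * B = 1) : XSurj A :=
  fun g hg => ⟨act B g, act_mem hB hg, by rw [← act_mul, h, act_one]⟩

theorem stock_vecMul {p k : ℕ} (L : Fin p → Op Ω) {R : Matrix (Fin p) (Fin k) (Op Ω)}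
    (hR : K.XMat R) (hs : XSurj R) : stock (L ᵥ* R) = stock L := by
  ext F
  rw [mem_stock, mem_stock]
  constructor
  · rintro ⟨φ, hφ, rfl⟩
    exact ⟨_, act_mem hR hφ, rowAct_vecMul L R φ⟩
  · rintro ⟨g, hg, rfl⟩
    obtain ⟨φ, hφ, rfl⟩ := hs g hg
    exact ⟨φ, hφ, (rowAct_vecMul L R φ).symm⟩

theorem vecMul_mem {m n : Type*} [Fintype m] {L : m → Op Ω} (hL : ∀ i, L i ∈ K.ops)
    {R : Matrix m n (Op Ω)} (hR : K.XMat R) (j : n) : (L ᵥ* R) j ∈ K.ops :=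
  sum_mem fun i _ => mul_mem (hL i) (xOps_le_ops (hR i j))

/-- Echelon matrices without zero rows are surjective. -/
theorem xSurj_of_isEchelon {p k : ℕ} {B : Matrix (Fin p) (Fin k) (Op Ω)} (hB : K.XMat B)
    (h : IsEchelon B p) : XSurj B := by
  obtain ⟨_, q, hq, hpiv, -⟩ := h
  have hpiv' : ∀ i : Fin p, B i (q i) ≠ 0 ∧ ∀ j < q i, B i j = 0 := hpiv
  intro g hg
  -- Back substitution: the last d equations are solved. The next one is solved by changing φ only
  -- in its pivot column, where all lower rows are zero.
  suffices h : ∀ d, ∃ φ : Fin k → Fun Ω, (∀ j, φ j ∈ xFun Ω) ∧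
      ∀ i : Fin p, p ≤ i + d → act B φ i = g i by
    obtain ⟨φ, hφ, h⟩ := h p
    exact ⟨φ, hφ, funext fun i => h i (by omega)⟩
  intro d
  induction d with
  | zero => exact ⟨0, fun _ => zero_mem _, fun i hi => absurd i.2 (by omega)⟩
  | succ d ih =>
    obtain ⟨φ, hφ, hd⟩ := ih
    by_cases hdp : ∃ i₀ : Fin p, (i₀ : ℕ) + (d + 1) = p
    · obtain ⟨i₀, hi₀⟩ := hdp
      obtain ⟨f, hf, hfe⟩ := exists_solution (hB i₀ (q i₀)) (hpiv' i₀).1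
        (sub_mem (hg i₀) (sum_mem (S := xFun Ω) (t := Finset.univ.erase (q i₀))
          (f := fun j => B i₀ j (φ j)) fun j _ => xOps_apply_mem (hB i₀ j) (hφ j)))
      have hupd : ∀ i, act B (Function.update φ (q i₀) f) i =
          B i (q i₀) f + ∑ j ∈ Finset.univ.erase (q i₀), B i j (φ j) := by
        intro i
        rw [act, ← Finset.add_sum_erase _ _ (Finset.mem_univ (q i₀)), Function.update_self]
        congr 1
        exact Finset.sum_congr rfl fun j hj => by
          rw [Function.update_of_ne (Finset.ne_of_mem_erase hj)]
      refine ⟨Function.update φ (q i₀) f, fun j => ?_, fun i hi => ?_⟩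
      · rcases eq_or_ne j (q i₀) with rfl | hj
        · rwa [Function.update_self]
        · rw [Function.update_of_ne hj]
          exact hφ j
      · rw [hupd]
        rcases eq_or_ne i i₀ with rfl | hne
        · rw [hfe, sub_add_cancel]
        · have hlt : i₀ < i := by
            have : (i : ℕ) ≠ i₀ := fun h => hne (Fin.ext h)
            exact Fin.lt_def.2 (by omega)
          rw [← hd i (by have := Fin.lt_def.1 hlt; omega), act,
            ← Finset.add_sum_erase _ _ (Finset.mem_univ (q i₀)), (hpiv' i).2 _ (hq hlt)]
          rfl
    · exact ⟨φ, hφ, fun i hi => hd i (by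
        have : (i : ℕ) + (d + 1) ≠ p := fun h => hdp ⟨i, h⟩
        omega)⟩

/-- A matrix has full row rank exactly when it is surjective on functions of `x`. -/
theorem hasRank_iff_xSurj [Nontrivial (Fun Ω)] {p k : ℕ} {S : Matrix (Fin p) (Fin k) (Op Ω)}
    (hS : K.XMat S) : HasRank K.xPart S p ↔ XSurj S := by
  constructor
  · rintro ⟨B, hred, hech⟩
    have hB := xMat_of_rowReduces hS hred
    obtain ⟨U, V, hU, hV, -, hVU, rfl⟩ := exists_eq_mul_of_rowReduces hred
    have h1 := (XSurj.of_mul_eq_one hU hVU).mul (xSurj_of_isEchelon hB hech)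
    rwa [← Matrix.mul_assoc, hVU, Matrix.one_mul] at h1
  · intro hs
    obtain ⟨B, r, hred, hech⟩ := exists_echelon S hS
    obtain ⟨U, V, hU, hV, hUV, -, rfl⟩ := exists_eq_mul_of_rowReduces hred
    have h1 : XSurj (U * S) := (XSurj.of_mul_eq_one hV hUV).mul hs
    obtain ⟨hrp, q, hq, hpiv, hzero⟩ := id hech
    -- A zero row could not produce the constant function 1.
    have hr : r = p := by
      by_contra hne
      obtain ⟨φ, -, h2⟩ := h1 (fun _ => 1) fun _ => one_mem _
      have h3 := congrFun h2 ⟨r, by omega⟩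
      rw [act, Finset.sum_eq_zero fun j _ => by rw [hzero ⟨r, by omega⟩ le_rfl j]; rfl] at h3
      exact zero_ne_one' (Fun Ω) h3
    subst hr
    exact ⟨_, hred, hech⟩

/-- Pivots lie in distinct columns. This supplies the size condition in the definition of
reducibility. -/
theorem le_of_isEchelon {p k r : ℕ} {B : Matrix (Fin p) (Fin k) (Op Ω)} (h : IsEchelon B r) :
    r ≤ k := by
  obtain ⟨-, q, hq, -⟩ := h
  simpa using Fintype.card_le_of_injective q hq.injective

/-! ### Coordinates in a basis -/

/-- A basis of the field over its subfield of functions of `x`. -/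
structure IsXBasis (K : FunctionField Ω) {ι : Type} (e : ι → Fun Ω) : Prop where
  mem : ∀ i, e i ∈ K.toSubring
  indep : ∀ (s : Finset ι) (c : ι → Fun Ω), (∀ i, c i ∈ K.xRing) → ∑ i ∈ s, c i * e i = 0 →
    ∀ i ∈ s, c i = 0
  span : ∀ f ∈ K.toSubring, ∃ (s : Finset ι) (c : ι → Fun Ω), (∀ i, c i ∈ K.xRing) ∧
    f = ∑ i ∈ s, c i * e i

variable {ι : Type} {e : ι → Fun Ω}

theorem mulOp_mem_ops {a : Fun Ω} (ha : a ∈ K.toSubring) : mulOp Ω a ∈ K.ops :=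
  opLT_le_opRing (by simpa using monomial_mem_opLT ha zero_lt_one)

/-- `A` is the matrix of coordinates of the operator row `L`, with rows supported on `s`. -/
structure IsCoord (K : FunctionField Ω) (e : ι → Fun Ω) {n : Type*} (L : n → Op Ω) (s : Finset ι)
    (A : Matrix ι n (Op Ω)) : Prop where
  xMat : K.XMat A
  eq_zero : ∀ i ∉ s, ∀ j, A i j = 0
  eq_sum : ∀ j, L j = ∑ i ∈ s, mulOp Ω (e i) * A i j

theorem IsCoord.mono {n : Type*} {L : n → Op Ω} {s t : Finset ι} {A : Matrix ι n (Op Ω)}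
    (h : IsCoord K e L s A) (hst : s ⊆ t) : IsCoord K e L t A where
  xMat := h.xMat
  eq_zero i hi := h.eq_zero i fun his => hi (hst his)
  eq_sum j := by
    rw [h.eq_sum j]
    exact Finset.sum_subset hst fun i _ hi => by rw [h.eq_zero i hi, mul_zero]

theorem IsCoord.mem_ops (he : K.IsXBasis e) {n : Type*} {L : n → Op Ω} {s : Finset ι}
    {A : Matrix ι n (Op Ω)} (h : IsCoord K e L s A) (j : n) : L j ∈ K.ops := by
  rw [h.eq_sum]
  exact sum_mem fun i _ => mul_mem (mulOp_mem_ops (he.mem i)) (xOps_le_ops (h.xMat i j))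

theorem IsXBasis.exists_coord (he : K.IsXBasis e) {k : ℕ} {L : Fin k → Op Ω}
    (hL : ∀ j, L j ∈ K.ops) : ∃ s A, IsCoord K e L s A := by
  classical
  -- The range of Φ is a subgroup, so it suffices to reach monomials. There the basis elements are
  -- moved to the left, past coefficients with which they commute.
  let Φ : (ι →₀ K.xOps) →+ Op Ω := Finsupp.liftAddHom fun i =>
    (AddMonoidHom.mulLeft (mulOp Ω (e i))).comp K.xOps.subtype.toAddMonoidHom
  have hΦ : ∀ c, Φ c = ∑ i ∈ c.support, mulOp Ω (e i) * (c i : Op Ω) := fun c => rfl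
  have hsingle : ∀ i c, Φ (Finsupp.single i c) = mulOp Ω (e i) * (c : Op Ω) := fun i c =>
    Finsupp.liftAddHom_apply_single _ _ _
  have hrange : ∀ P ∈ K.ops, P ∈ Φ.range := by
    intro P hP
    obtain ⟨n, hn⟩ := mem_opRing.1 hP
    refine opLT_induction hn fun a ha i _ => ?_
    obtain ⟨s, c, hc, rfl⟩ := he.span a ha
    rw [map_sum, Finset.sum_mul]
    refine sum_mem fun b _ => ⟨Finsupp.single b ⟨mulOp Ω (c b) * Dx Ω ^ i,
      opLT_le_opRing (monomial_mem_opLT (hc b) i.lt_succ_self)⟩, ?_⟩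
    rw [hsingle, mul_comm (c b), map_mul, mul_assoc]
  choose c hc using fun j => hrange (L j) (hL j)
  refine ⟨Finset.univ.biUnion fun j => (c j).support, fun i j => c j i, fun i j => (c j i).2,
    fun i hi j => ?_, fun j => ?_⟩
  · have : i ∉ (c j).support := fun h => hi (Finset.mem_biUnion.2 ⟨j, Finset.mem_univ j, h⟩)
    rw [Finsupp.notMem_support_iff.1 this]
    rfl
  · rw [← hc, hΦ]
    exact Finset.sum_subset (Finset.subset_biUnion_of_mem (fun j => (c j).support)
      (Finset.mem_univ j)) fun i _ hi => by
      rw [Finsupp.notMem_support_iff.1 hi, ZeroMemClass.coe_zero, mul_zero]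

theorem IsCoord.rowAct_eq {n : Type*} [Fintype n] {L : n → Op Ω} {s : Finset ι}
    {A : Matrix ι n (Op Ω)} (h : IsCoord K e L s A) (φ : n → Fun Ω) :
    rowAct L φ = ∑ i ∈ s, act A φ i * e i := by
  have h1 : ∀ j, L j (φ j) = ∑ i ∈ s, e i * A i j (φ j) := fun j => by
    rw [h.eq_sum, op_sum_apply]
    rfl
  simp only [rowAct, act, h1, Finset.sum_mul]
  rw [Finset.sum_comm]
  exact Finset.sum_congr rfl fun i _ => Finset.sum_congr rfl fun j _ => mul_comm _ _

/-- Equal values of two rows on functions of `x` have equal coordinates. -/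
theorem IsXBasis.act_eq_act (he : K.IsXBasis e) {m n : Type*} [Fintype m] [Fintype n]
    {L : m → Op Ω} {L' : n → Op Ω} {s : Finset ι} {A : Matrix ι m (Op Ω)} {A' : Matrix ι n (Op Ω)}
    (h : IsCoord K e L s A) (h' : IsCoord K e L' s A') {φ : m → Fun Ω} {φ' : n → Fun Ω}
    (hφ : ∀ i, φ i ∈ xFun Ω) (hφ' : ∀ i, φ' i ∈ xFun Ω) (heq : rowAct L φ = rowAct L' φ') :
    ∀ i ∈ s, act A φ i = act A' φ' i := by
  have h1 := indep_xFun s e (fun i _ => he.mem i) (fun c hc => he.indep s c hc)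
    (fun i => act A φ i - act A' φ' i)
    (fun i => sub_mem (act_mem h.xMat hφ i) (act_mem h'.xMat hφ' i)) (by
      simp only [sub_mul, Finset.sum_sub_distrib]
      rw [← h.rowAct_eq, ← h'.rowAct_eq, heq, sub_self])
  exact fun i hi => sub_eq_zero.1 (h1 i hi)

/-- Testing the row on columns with a single non-zero entry isolates each coordinate operator, and
operators over K are determined by their values on functions of x. -/
theorem IsXBasis.coord_unique (he : K.IsXBasis e) {n : Type*} [Fintype n] {L : n → Op Ω}
    {s : Finset ι} {A A' : Matrix ι n (Op Ω)} (h : IsCoord K e L s A) (h' : IsCoord K e L s A') :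
    A = A' := by
  classical
  ext1 i j
  by_cases hi : i ∈ s
  · refine ops_ext (xOps_le_ops (h.xMat i j)) (xOps_le_ops (h'.xMat i j)) fun f hf => ?_
    have hact : ∀ B : Matrix ι n (Op Ω), act B (Pi.single j f) i = B i j f := fun B =>
      rowAct_single (B i) j f
    rw [← hact, ← hact]
    exact he.act_eq_act h h' (single_mem_xFun hf) (single_mem_xFun hf) rfl i hi
  · rw [h.eq_zero i hi, h'.eq_zero i hi]

theorem IsCoord.vecMul {m n : Type*} [Fintype m] {L : m → Op Ω} {s : Finset ι}
    {A : Matrix ι m (Op Ω)} (h : IsCoord K e L s A) {R : Matrix m n (Op Ω)} (hR : K.XMat R) :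
    IsCoord K e (L ᵥ* R) s (A * R) where
  xMat := h.xMat.mul hR
  eq_zero i hi j := Finset.sum_eq_zero fun a _ =>
    (congrArg (· * R a j) (h.eq_zero i hi a)).trans (zero_mul _)
  eq_sum j := by
    change ∑ a, L a * R a j = ∑ i ∈ s, mulOp Ω (e i) * ∑ a, A i a * R a j
    simp only [h.eq_sum, Finset.sum_mul, Finset.mul_sum, mul_assoc]
    exact Finset.sum_comm

/-! ### Irreducible rows -/

/-- The product of matrices with inner index set `ι`, the summation being restricted to `s`. -/
def mulOn (s : Finset ι) {m n : Type*} (T : Matrix m ι (Op Ω)) (A : Matrix ι n (Op Ω)) :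
    Matrix m n (Op Ω) := fun j j' => ∑ i ∈ s, T j i * A i j'

theorem mulOn_mul (s : Finset ι) {l m n : Type*} [Fintype m] (T : Matrix l ι (Op Ω))
    (A : Matrix ι m (Op Ω)) (B : Matrix m n (Op Ω)) : mulOn s T (A * B) = mulOn s T A * B := by
  ext1 j j'
  change ∑ i ∈ s, T j i * ∑ a, A i a * B a j' = ∑ a, (∑ i ∈ s, T j i * A i a) * B a j'
  simp only [Finset.sum_mul, Finset.mul_sum, mul_assoc]
  exact Finset.sum_comm

theorem mul_mulOn (s : Finset ι) {l m n : Type*} [Fintype m] (B : Matrix l m (Op Ω))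
    (T : Matrix m ι (Op Ω)) (A : Matrix ι n (Op Ω)) : mulOn s (B * T) A = B * mulOn s T A := by
  ext1 j j'
  change ∑ i ∈ s, (∑ a, B j a * T a i) * A i j' = ∑ a, B j a * ∑ i ∈ s, T a i * A i j'
  simp only [Finset.sum_mul, Finset.mul_sum, mul_assoc]
  exact Finset.sum_comm

theorem XMat.mulOn (s : Finset ι) {m n : Type*} {T : Matrix m ι (Op Ω)} {A : Matrix ι n (Op Ω)}
    (hT : K.XMat T) (hA : K.XMat A) : K.XMat (mulOn s T A) := fun j j' =>
  sum_mem fun i _ => mul_mem (hT j i) (hA i j')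

theorem IsCoord.mulOn_eq {s t : Finset ι} (hst : s ⊆ t) {m n : Type*} {L : n → Op Ω}
    {T : Matrix m ι (Op Ω)} {A : Matrix ι n (Op Ω)} (h : IsCoord K e L s A) :
    mulOn s T A = mulOn t T A := by
  ext1 j j'
  exact Finset.sum_subset hst fun i _ hi => by rw [h.eq_zero i hi, mul_zero]

theorem act_mulOn (s : Finset ι) {m n : Type*} [Fintype n] (T : Matrix m ι (Op Ω))
    (A : Matrix ι n (Op Ω)) (φ : n → Fun Ω) (j : m) :
    act (mulOn s T A) φ j = ∑ i ∈ s, T j i (act A φ i) := by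
  have h : ∀ j', mulOn s T A j j' (φ j') = ∑ i ∈ s, T j i (A i j' (φ j')) := fun j' =>
    op_sum_apply _ _ _
  simp only [act, h, map_sum]
  exact Finset.sum_comm

/-- The row has a coordinate matrix with a left inverse. -/
def HasLeftInv (K : FunctionField Ω) (e : ι → Fun Ω) {k : ℕ} (L : Fin k → Op Ω) : Prop :=
  ∃ s A, IsCoord K e L s A ∧ ∃ T : Matrix (Fin k) ι (Op Ω), K.XMat T ∧ mulOn s T A = 1

theorem HasLeftInv.vecMul {p k : ℕ} {L : Fin p → Op Ω} (h : K.HasLeftInv e L)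
    {R : Matrix (Fin p) (Fin k) (Op Ω)} {G : Matrix (Fin k) (Fin p) (Op Ω)} (hR : K.XMat R)
    (hG : K.XMat G) (hGR : G * R = 1) : K.HasLeftInv e (L ᵥ* R) := by
  obtain ⟨s, A, hA, T, hT, hTA⟩ := h
  exact ⟨s, A * R, hA.vecMul hR, G * T, hG.mul hT, by
    rw [mulOn_mul, mul_mulOn, hTA, Matrix.mul_one, hGR]⟩

/-- Uniqueness of coordinates carries a factorization of the row over to `A`, so the left inverse of
`A` yields one of the right factor `R`. The condition p ≤ k makes it two-sided. -/
theorem HasLeftInv.irred [Nontrivial (Fun Ω)] (he : K.IsXBasis e) {k : ℕ} {L : Fin k → Op Ω}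
    (h : K.HasLeftInv e L) : Irred K L := by
  classical
  obtain ⟨s, A, hA, T, hT, hTA⟩ := h
  refine ⟨hA.mem_ops he, ?_⟩
  rintro ⟨p, M, R, hpk, hM, hR, hninv, rfl⟩
  rw [← xMat_iff] at hR
  obtain ⟨s', A', hA'⟩ := he.exists_coord (L := M) hM
  have hAA' : A = A' * R := he.coord_unique (hA.mono Finset.subset_union_left)
    ((hA'.vecMul hR).mono (Finset.subset_union_right (s₁ := s)))
  have hW : mulOn s T A' * R = 1 := by rw [← mulOn_mul, ← hAA', hTA]
  have hWx : K.XMat (mulOn s T A') := hT.mulOn s hA'.xMat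
  exact hninv (matInvertible_iff.2 ⟨_, hWx, (eq_and_mul_eq_one hR hWx hW hpk).2, hW⟩)

/-- Every row is the product of a row with left invertible coordinates and an echelon matrix
without zero rows. -/
theorem IsXBasis.exists_factorization (he : K.IsXBasis e) {k : ℕ} {L : Fin k → Op Ω}
    (hL : ∀ j, L j ∈ K.ops) : ∃ (q : ℕ) (M : Fin q → Op Ω) (H : Matrix (Fin q) (Fin k) (Op Ω)),
      K.HasLeftInv e M ∧ K.XMat H ∧ IsEchelon H q ∧ L = M ᵥ* H := by
  classical
  obtain ⟨s, A, hA⟩ := he.exists_coord hL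
  let σ := s.equivFin
  obtain ⟨B, q, hred, hech⟩ := exists_echelon (K := K) (A.submatrix (fun a => (σ.symm a : ι)) id)
    fun _ _ => hA.xMat _ _
  have hBx : K.XMat B := xMat_of_rowReduces (fun _ _ => hA.xMat _ _) hred
  obtain ⟨U, V, hU, hV, hUV, hVU, hB⟩ := exists_eq_mul_of_rowReduces hred
  obtain ⟨hr, piv, hmono, hpiv, hzero⟩ := hech
  have hAV : A.submatrix (fun a => (σ.symm a : ι)) id = V * B := by
    rw [hB, ← Matrix.mul_assoc, hVU, Matrix.one_mul]
  -- Only the first q rows of `B` are non-zero, so `A = VB` needs only those rows and the first q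
  -- columns of `V`. The first q rows of `U` are a left inverse of these columns, as a corner of `UV
  -- = 1`.
  let H : Matrix (Fin q) (Fin k) (Op Ω) := B.submatrix (Fin.castLE hr) id
  let A₀ : Matrix ι (Fin q) (Op Ω) := fun i b =>
    if h : i ∈ s then V (σ ⟨i, h⟩) (Fin.castLE hr b) else 0
  let T : Matrix (Fin q) ι (Op Ω) := fun b i =>
    if h : i ∈ s then U (Fin.castLE hr b) (σ ⟨i, h⟩) else 0
  have hA₀ : IsCoord K e (fun b => ∑ i ∈ s, mulOp Ω (e i) * A₀ i b) s A₀ :=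
    { xMat := fun i b => by
        by_cases h : i ∈ s
        · simp only [A₀, dif_pos h]
          exact hV _ _
        · simp only [A₀, dif_neg h]
          exact zero_mem _
      eq_zero := fun i hi b => by simp only [A₀, dif_neg hi]
      eq_sum := fun _ => rfl }
  have hH : K.XMat H := fun _ _ => hBx _ _
  have hA₀H : A = A₀ * H := by
    ext1 i j
    by_cases hi : i ∈ s
    · have h1 : A i j = (V * B) (σ ⟨i, hi⟩) j := by
        rw [← hAV, Matrix.submatrix_apply, Equiv.symm_apply_apply]
        rfl
      have h2 : (A₀ * H) i j = ∑ b : Fin q, V (σ ⟨i, hi⟩) (Fin.castLE hr b) *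
          B (Fin.castLE hr b) j := by
        rw [Matrix.mul_apply]
        simp only [A₀, dif_pos hi]
        rfl
      rw [h1, h2, Matrix.mul_apply]
      symm
      refine Finset.sum_of_injOn (Fin.castLE hr) (Fin.castLE_injective hr).injOn
        (fun _ _ => Finset.mem_coe.2 (Finset.mem_univ _)) (fun a _ ha => ?_) fun _ _ => rfl
      have haq : q ≤ (a : ℕ) := by
        by_contra hlt
        exact ha ⟨⟨a, by omega⟩, Finset.mem_coe.2 (Finset.mem_univ _), rfl⟩
      rw [hzero a haq, mul_zero]
    · rw [hA.eq_zero i hi, (hA₀.vecMul hH).eq_zero i hi]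
  refine ⟨q, _, H, ⟨s, A₀, hA₀, T, fun b i => ?_, ?_⟩, hH,
    ⟨le_rfl, piv, hmono, fun i => hpiv i, fun i hi => absurd i.2 (by omega)⟩, ?_⟩
  · by_cases h : i ∈ s
    · simp only [T, dif_pos h]
      exact hU _ _
    · simp only [T, dif_neg h]
      exact zero_mem _
  · ext1 b b'
    have h1 : mulOn s T A₀ b b' = (U * V) (Fin.castLE hr b) (Fin.castLE hr b') := by
      rw [mulOn, Matrix.mul_apply, ← σ.sum_comp, ← Finset.sum_coe_sort]
      refine Finset.sum_congr rfl fun i _ => ?_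
      simp only [T, A₀, dif_pos i.2]
    rw [h1, hUV, Matrix.one_apply, Matrix.one_apply]
    simp only [(Fin.castLE_injective hr).eq_iff]
  · funext j
    rw [hA.eq_sum, (hA₀.vecMul hH).eq_sum, ← hA₀H]

/-- In the factorization `L = MH` the echelon factor has at most k rows, so irreducibility forces it
to be invertible, and the left inverse passes from `M` to `L`. -/
theorem IsXBasis.hasLeftInv_of_irred (he : K.IsXBasis e) {k : ℕ} {L : Fin k → Op Ω}
    (h : Irred K L) : K.HasLeftInv e L := by
  obtain ⟨q, M, H, hM, hH, hech, rfl⟩ := he.exists_factorization h.1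
  have hMops : RowOver K.carrier M := by
    obtain ⟨s, A, hA, -⟩ := hM
    exact hA.mem_ops he
  have hinv : MatInvertible K.xPart H := by
    by_contra hninv
    exact h.2 ⟨q, M, H, le_of_isEchelon hech, hMops, xMat_iff.1 hH, hninv, rfl⟩
  obtain ⟨G, hG, -, hGH⟩ := matInvertible_iff.1 hinv
  exact hM.vecMul hH hG hGH

/-- The argument of a row with left invertible coordinates is an operator expression in the
arguments of any row taking the same values. -/
theorem HasLeftInv.exists_argument (he : K.IsXBasis e) {p m : ℕ} {L₀ : Fin p → Op Ω}
    (h : K.HasLeftInv e L₀) {L₁ : Fin m → Op Ω} (hL₁ : ∀ j, L₁ j ∈ K.ops) :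
    ∃ S : Matrix (Fin p) (Fin m) (Op Ω), K.XMat S ∧ ∀ (φ : Fin m → Fun Ω) (ψ : Fin p → Fun Ω),
      (∀ j, φ j ∈ xFun Ω) → (∀ j, ψ j ∈ xFun Ω) → rowAct L₁ φ = rowAct L₀ ψ → ψ = act S φ := by
  classical
  obtain ⟨s, A, hA, T, hT, hTA⟩ := h
  obtain ⟨s', A', hA'⟩ := he.exists_coord hL₁
  refine ⟨mulOn (s ∪ s') T A', hT.mulOn _ hA'.xMat, fun φ ψ hφ hψ heq => funext fun j => ?_⟩
  have h1 := he.act_eq_act (hA'.mono (Finset.subset_union_right (s₁ := s)))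
    (hA.mono (Finset.subset_union_left (s₂ := s'))) hφ hψ heq
  rw [act_mulOn, Finset.sum_congr rfl fun i hi => by rw [h1 i hi], ← act_mulOn,
    ← hA.mulOn_eq Finset.subset_union_left, hTA, act_one]

/-- Rows with a given stock are obtained from a row with left invertible coordinates by
multiplication by matrices of full row rank. -/
theorem HasLeftInv.stock_eq_iff [Nontrivial (Fun Ω)] (he : K.IsXBasis e) {p m : ℕ}
    {L₀ : Fin p → Op Ω} (h : K.HasLeftInv e L₀) {L₁ : Fin m → Op Ω} :
    (RowOver K.carrier L₁ ∧ stock L₁ = stock L₀) ↔ ∃ S : Matrix (Fin p) (Fin m) (Op Ω),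
      MatOver K.xPart S ∧ HasRank K.xPart S p ∧ L₁ = L₀ ᵥ* S := by
  have hL₀ : ∀ j, L₀ j ∈ K.ops := by
    obtain ⟨s, A, hA, -⟩ := h
    exact hA.mem_ops he
  constructor
  · rintro ⟨hL₁, hst⟩
    obtain ⟨S, hS, harg⟩ := h.exists_argument he (L₁ := L₁) hL₁
    have hval : ∀ φ : Fin m → Fun Ω, (∀ j, φ j ∈ xFun Ω) → rowAct L₁ φ = rowAct L₀ (act S φ) := by
      intro φ hφ
      obtain ⟨ψ, hψ, heq⟩ := mem_stock.1 (hst ▸ mem_stock.2 ⟨φ, hφ, rfl⟩)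
      rw [heq, harg φ ψ hφ hψ heq]
    refine ⟨S, xMat_iff.1 hS, (hasRank_iff_xSurj hS).2 fun ψ hψ => ?_, funext fun j => ?_⟩
    · obtain ⟨φ, hφ, heq⟩ := mem_stock.1 (hst.symm ▸ mem_stock.2 ⟨ψ, hψ, rfl⟩)
      exact ⟨φ, hφ, (harg φ ψ hφ hψ heq.symm).symm⟩
    · refine ops_ext (hL₁ j) (vecMul_mem hL₀ hS j) fun f hf => ?_
      have h1 := hval (Pi.single j f) (single_mem_xFun hf)
      rw [← rowAct_vecMul, rowAct_single, rowAct_single] at h1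
      exact h1
  · rintro ⟨S, hS, hrank, rfl⟩
    rw [← xMat_iff] at hS
    exact ⟨vecMul_mem hL₀ hS, stock_vecMul L₀ hS ((hasRank_iff_xSurj hS).1 hrank)⟩

/-- Right multiplication by an invertible matrix preserves irreducibility and the stock. -/
theorem HasLeftInv.irred_vecMul [Nontrivial (Fun Ω)] (he : K.IsXBasis e) {p q : ℕ}
    {L : Fin p → Op Ω} (h : K.HasLeftInv e L) {R : Matrix (Fin p) (Fin q) (Op Ω)}
    (hR : K.XMat R) (hinv : MatInvertible K.xPart R) :
    Irred K (L ᵥ* R) ∧ stock (L ᵥ* R) = stock L := by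
  obtain ⟨G, hG, hRG, hGR⟩ := matInvertible_iff.1 hinv
  exact ⟨(h.vecMul hR hG hGR).irred he, stock_vecMul L hR (XSurj.of_mul_eq_one hG hRG)⟩

end FunctionField

end EulerInt

end

theorem mainTheorem8 (Ω : TopologicalSpace.Opens (ℝ × ℝ)) (hΩ : (Ω : Set (ℝ × ℝ)).Nonempty)
    (K : EulerInt.FunctionField Ω)
    (k : ℕ) (L : Fin k → EulerInt.Op Ω) (hL : EulerInt.RowOver K.carrier L) :
    (∃ (p : ℕ) (L₀ : Fin p → EulerInt.Op Ω),
      EulerInt.Irred K L₀ ∧ EulerInt.stock L₀ = EulerInt.stock L) ∧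
    ∀ (p : ℕ) (L₀ : Fin p → EulerInt.Op Ω),
      EulerInt.Irred K L₀ → EulerInt.stock L₀ = EulerInt.stock L →
      (∀ (q : ℕ) (L₁ : Fin q → EulerInt.Op Ω),
        (EulerInt.Irred K L₁ ∧ EulerInt.stock L₁ = EulerInt.stock L) ↔
          ∃ R : Matrix (Fin p) (Fin q) (EulerInt.Op Ω),
            EulerInt.MatOver K.xPart R ∧ EulerInt.MatInvertible K.xPart R ∧ L₁ = L₀ ᵥ* R) ∧
      (∀ (m : ℕ) (L₁ : Fin m → EulerInt.Op Ω),
        (EulerInt.RowOver K.carrier L₁ ∧ EulerInt.stock L₁ = EulerInt.stock L) ↔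
          ∃ S : Matrix (Fin p) (Fin m) (EulerInt.Op Ω),
            EulerInt.MatOver K.xPart S ∧ EulerInt.HasRank K.xPart S p ∧ L₁ = L₀ ᵥ* S) := by
  have hnt : Nontrivial (EulerInt.Fun Ω) := EulerInt.nontrivial_fun hΩ
  obtain ⟨ι, e, h1, h2, h3⟩ := K.exists_basis
  have he : K.IsXBasis e := ⟨h1, h2, h3⟩
  refine ⟨?_, fun p L₀ hirr hst => ?_⟩
  · obtain ⟨q, M, H, hM, hH, hech, rfl⟩ := he.exists_factorization hL
    exact ⟨q, M, hM.irred he, (EulerInt.FunctionField.stock_vecMul M hH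
      (EulerInt.FunctionField.xSurj_of_isEchelon hH hech)).symm⟩
  have hL₀ := he.hasLeftInv_of_irred hirr
  rw [← hst]
  refine ⟨fun q L₁ => ⟨fun ⟨hirr₁, hst₁⟩ => ?_, fun ⟨R, hR, hinv, h⟩ => ?_⟩,
    fun m L₁ => hL₀.stock_eq_iff he⟩
  · obtain ⟨S, hS, hrank, rfl⟩ := (hL₀.stock_eq_iff he).1 ⟨hirr₁.1, hst₁⟩
    refine ⟨S, hS, ?_, rfl⟩
    obtain ⟨B, -, hech⟩ := hrank
    by_contra hninv
    exact hirr₁.2 ⟨p, L₀, S, EulerInt.FunctionField.le_of_isEchelon hech, hirr.1, hS, hninv, rfl⟩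
  · rw [h]
    exact hL₀.irred_vecMul he (EulerInt.FunctionField.xMat_iff.2 hR) hinv
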